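/- All Hilbert spaces are complex. For $\nu\in\mathbb{R}$ and a Hilbert space $H$ let $H_{\nu,0}(\mathbb{R};H)$ be the space of $H$-valued functions that are square-integrable with respect to $\exp(-2\nu t)\,\mathrm{d}t$. For $\nu>0$ let $\partial_0=\partial_{0,\nu}$ be the closure in $H_{\nu,0}(\mathbb{R};H)$ of the derivative on $C_c^\infty(\mathbb{R};H)$, and let $\mathcal{L}_\nu=\mathcal{F}e^{-\nu m}:H_{\nu,0}(\mathbb{R};H)\to L_2(\mathbb{R};H)$ be the unitary Fourier–Laplace transform, where $(e^{-\nu m}f)(t)=e^{-\nu t}f(t)$ and $\mathcal{F}$ is the unitary Fourier transform with kernel $(2\pi)^{-1/2}e^{-\mathrm{i}xt}$. A linear material law on $H$ is a bounded analytic function $M:B_{\mathbb{C}}(r,r)\to L(H)$, where $r>0$ and $B_{\mathbb{C}}(r,r)$ is the open disc with centre $r$ and radius $r$; for $\nu>\frac{1}{2r}$ it defines the bounded operator $M(\partial_0^{-1})=\mathcal{L}_\nu^{*}\,M\!\left(\tfrac{1}{\mathrm{i}m+\nu}\right)\mathcal{L}_\nu$ on $H_{\nu,0}(\mathbb{R};H)$,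 where $M(\frac{1}{\mathrm{i}m+\nu})$ is multiplication by $x\mapsto M(\frac{1}{\mathrm{i}x+\nu})$ on $L_2(\mathbb{R};H)$. A densely defined closed operator $A$ in $H$ is extended to $H_{\nu,0}(\mathbb{R};H)$ as the closure of $(Af)(t)=A\,f(t)$ on simple functions with values in $D(A)$. An abstract linear control system $\mathcal{C}_{M,F,B}$ consists of Hilbert spaces $H_0,H_1,U,Y$, a densely defined closed linear operator $F:D(F)\subseteq H_0\to H_1$, a linear material law $K:B_{\mathbb{C}}(r,r)\to L(H_0\oplus H_1)$, operators $M_{1,i2}\in L(Y;H_i)$, $M_{1,2i}\in L(H_i;Y)$ $(i\in\{0,1\})$, $M_{1,22}\in L(Y)$, and control operators $B\in L(H_{\nu,0}(\mathbb{R};U);H_{\nu,0}(\mathbb{R};H_0\oplus H_1\oplus Y))$. Put $$M(z)=\begin{pmatrix}K(z)&0\\0&0\end{pmatrix}+z\begin{pmatrix}0&\begin{pmatrix}M_{1,02}\\M_{1,12}\end{pmatrix}\\ \begin{pmatrix}M_{1,20}&M_{1,21}\end{pmatrix}&M_{1,22}\end{pmatrix},\qquad A=\begin{pmatrix}0&F^*&0\\-F&0&0\\0&0&0\end{pmatrix},\qquad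 J=\frac12\begin{pmatrix}M_{1,02}+M_{1,20}^*\\M_{1,12}+M_{1,21}^*\end{pmatrix}\in L(Y;H_0\oplus H_1).$$ The system, i.e. the equation $(\partial_0M(\partial_0^{-1})+A)w=f+Bu$, is called well-posed if for all sufficiently large $\nu$ the operator $\partial_0M(\partial_0^{-1})+A$ (with its natural domain) in $H_{\nu,0}(\mathbb{R};H_0\oplus H_1\oplus Y)$ possesses a densely defined bounded inverse; the continuation of this inverse to the whole space is called the solution operator. An operator $T$ on $H_{\nu,0}(\mathbb{R};H)$ is causal if $\chi_{(-\infty,a]}(m)\,T\,\chi_{(-\infty,a]}(m)=\chi_{(-\infty,a]}(m)\,T$ for every $a\in\mathbb{R}$, where $\chi_{(-\infty,a]}(m)$ is multiplication by the indicator function of $(-\infty,a]$. **Theorem.** Let $\mathcal{C}_{M,F,B}$ be an abstract linear control system. Assume that there are $c_0,c_1>0$ with $\operatorname{Re}z^{-1}K(z)\ge c_0$ for all $z\in B_{\mathbb{C}}(r,r)$ and $\operatorname{Re}M_{1,22}\ge c_1$ (where $\operatorname{Re}T=\frac12(T+T^*)$), and that there is $\delta>0$ such that $c_0-\delta\|J\|>0$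 and $c_1-\frac1\delta\|J\|>0$. Then $\mathcal{C}_{M,F,B}$ is well-posed and, for all sufficiently large $\nu$, its solution operator is causal. -/

import Mathlib

open MeasureTheory
open scoped ENNReal

noncomputable section

namespace ControlSystems

/-! ### Exponentially weighted spaces -/

/-- The exponentially weighted Lebesgue measure `exp(-2νt) dt` on `ℝ`. -/
def expMeasure (ν : ℝ) : Measure ℝ :=
  volume.withDensity fun t => ENNReal.ofReal (Real.exp (-2 * ν * t))

/-- The space `H_{ν,0}(ℝ; H)`: (classes of) `H`-valued functions that are square-integrable with
respect to `exp(-2νt) dt`; its inner product is `∫ ⟪f t, g t⟫ exp(-2νt) dt`. -/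
abbrev HSpace (ν : ℝ) (H : Type*) [NormedAddCommGroup H] : Type _ :=
  Lp H 2 (expMeasure ν)

theorem measurable_expDensity (ν : ℝ) :
    Measurable fun t : ℝ => ENNReal.ofReal (Real.exp (-2 * ν * t)) := by
  fun_prop

theorem expMeasure_ac (ν : ℝ) : expMeasure ν ≪ volume :=
  withDensity_absolutelyContinuous _ _

theorem ac_expMeasure (ν : ℝ) : volume ≪ expMeasure ν := by
  refine withDensity_absolutelyContinuous' (measurable_expDensity ν).aemeasurable ?_
  filter_upwards with t
  simp [Real.exp_pos]

section Unitary

variable {H : Type*} [NormedAddCommGroup H] [InnerProductSpace ℂ H]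

theorem eLpNorm_expMul (ν : ℝ) (f : ℝ → H) :
    eLpNorm (fun t => (Real.exp (-ν * t) : ℂ) • f t) 2 volume = eLpNorm f 2 (expMeasure ν) := by
  rw [eLpNorm_eq_lintegral_rpow_enorm_toReal (by norm_num) (by norm_num),
    eLpNorm_eq_lintegral_rpow_enorm_toReal (by norm_num) (by norm_num), expMeasure,
    lintegral_withDensity_eq_lintegral_mul_non_measurable _ (measurable_expDensity ν)
      (Filter.Eventually.of_forall fun _ => ENNReal.ofReal_lt_top)]
  congr 1
  refine lintegral_congr fun t => ?_
  have h1 : ‖(Real.exp (-ν * t) : ℂ)‖ₑ = ENNReal.ofReal (Real.exp (-ν * t)) := by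
    rw [← ofReal_norm, Complex.norm_real, Real.norm_of_nonneg (Real.exp_pos _).le]
  simp only [enorm_smul, Pi.mul_apply, ENNReal.toReal_ofNat]
  rw [ENNReal.mul_rpow_of_nonneg _ _ (by norm_num), h1,
    ENNReal.ofReal_rpow_of_nonneg (Real.exp_pos _).le (by norm_num), ← Real.exp_mul]
  congr 3
  ring

theorem memLp_expMul {ν : ℝ} {f : ℝ → H} (hf : MemLp f 2 (expMeasure ν)) :
    MemLp (fun t => (Real.exp (-ν * t) : ℂ) • f t) 2 volume := by
  refine ⟨?_, by rw [eLpNorm_expMul]; exact hf.2⟩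
  refine AEStronglyMeasurable.smul ?_ (hf.1.mono_ac (ac_expMeasure ν))
  exact (by fun_prop : Continuous fun t : ℝ => (Real.exp (-ν * t) : ℂ)).aestronglyMeasurable

theorem memLp_expMul_inv {ν : ℝ} {f : ℝ → H} (hf : MemLp f 2 volume) :
    MemLp (fun t => (Real.exp (ν * t) : ℂ) • f t) 2 (expMeasure ν) := by
  have h : (fun t => (Real.exp (-ν * t) : ℂ) • ((Real.exp (ν * t) : ℂ) • f t)) = f := by
    funext t
    rw [smul_smul, ← Complex.ofReal_mul, ← Real.exp_add]
    simp
  refine ⟨?_, by rw [← eLpNorm_expMul, h]; exact hf.2⟩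
  refine AEStronglyMeasurable.smul ?_ (hf.1.mono_ac (expMeasure_ac ν))
  exact (by fun_prop : Continuous fun t : ℝ => (Real.exp (ν * t) : ℂ)).aestronglyMeasurable

/-- The unitary operator `e^{-νm} : H_{ν,0}(ℝ; H) → L²(ℝ; H)`, `f ↦ (t ↦ e^{-νt} f(t))`. -/
def expMul (ν : ℝ) (H : Type*) [NormedAddCommGroup H] [InnerProductSpace ℂ H] :
    HSpace ν H ≃ₗᵢ[ℂ] Lp H 2 (volume : Measure ℝ) where
  toFun f := (memLp_expMul (Lp.memLp f)).toLp _
  invFun f := (memLp_expMul_inv (ν := ν) (Lp.memLp f)).toLp _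
  map_add' f g := by
    apply Lp.ext
    refine (MemLp.coeFn_toLp _).trans ?_
    filter_upwards [Lp.coeFn_add (MemLp.toLp _ (memLp_expMul (Lp.memLp f)))
      (MemLp.toLp _ (memLp_expMul (Lp.memLp g))), MemLp.coeFn_toLp (memLp_expMul (Lp.memLp f)),
      MemLp.coeFn_toLp (memLp_expMul (Lp.memLp g)),
      (ac_expMeasure ν).ae_le (Lp.coeFn_add f g)] with t h1 h2 h3 h4
    rw [h1, Pi.add_apply, h2, h3, h4, Pi.add_apply, smul_add]
  map_smul' c f := by
    apply Lp.ext
    refine (MemLp.coeFn_toLp _).trans ?_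
    filter_upwards [Lp.coeFn_smul c (MemLp.toLp _ (memLp_expMul (Lp.memLp f))),
      MemLp.coeFn_toLp (memLp_expMul (Lp.memLp f)),
      (ac_expMeasure ν).ae_le (Lp.coeFn_smul c f)] with t h1 h2 h4
    rw [RingHom.id_apply, h1, Pi.smul_apply, h2, h4, Pi.smul_apply, smul_comm]
  left_inv f := by
    apply Lp.ext
    refine (MemLp.coeFn_toLp _).trans ?_
    filter_upwards [(expMeasure_ac ν).ae_le
      (MemLp.coeFn_toLp (memLp_expMul (Lp.memLp f)))] with t h
    rw [h, smul_smul, ← Complex.ofReal_mul, ← Real.exp_add]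
    simp
  right_inv f := by
    apply Lp.ext
    refine (MemLp.coeFn_toLp _).trans ?_
    filter_upwards [(ac_expMeasure ν).ae_le
      (MemLp.coeFn_toLp (memLp_expMul_inv (ν := ν) (Lp.memLp f)))] with t h
    rw [h, smul_smul, ← Complex.ofReal_mul, ← Real.exp_add]
    simp
  norm_map' f := by
    change ‖MemLp.toLp _ (memLp_expMul (Lp.memLp f))‖ = _
    rw [Lp.norm_toLp, eLpNorm_expMul, Lp.norm_def]

/-- The Fourier–Laplace transform `𝓛_ν = 𝓕 e^{-νm} : H_{ν,0}(ℝ; H) → L²(ℝ; H)`, a unitary operator.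
Here `𝓕` is Mathlib's Fourier transform `∫ e^{-2πixt} f(t) dt` on `L²`, so that `x` corresponds to
the angular frequency `2πx` of the convention `(2π)^{-1/2} ∫ e^{-ist} f(t) dt`. -/
def fourierLaplace (ν : ℝ) (H : Type*) [NormedAddCommGroup H] [InnerProductSpace ℂ H]
    [CompleteSpace H] : HSpace ν H ≃ₗᵢ[ℂ] Lp H 2 (volume : Measure ℝ) :=
  (expMul ν H).trans (Lp.fourierTransformₗᵢ ℝ H)

end Unitary

/-! ### The time derivative, causality, extension of spatial operators

Unbounded operators on `H_{ν,0}(ℝ; H)` are given by their graphs, i.e. as linear subspaces of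
`H_{ν,0}(ℝ; H) × H_{ν,0}(ℝ; H)`. -/

section Operators

variable {H : Type*} [NormedAddCommGroup H] [InnerProductSpace ℂ H]

/-- The graph of `φ ↦ φ'` on `C_c^∞(ℝ; H)`, as an operator in `H_{ν,0}(ℝ; H)`. -/
def testDerivGraph (ν : ℝ) (H : Type*) [NormedAddCommGroup H] [InnerProductSpace ℂ H] :
    Submodule ℂ (HSpace ν H × HSpace ν H) where
  carrier := {p | ∃ φ : ℝ → H, ContDiff ℝ (⊤ : ℕ∞) φ ∧ HasCompactSupport φ ∧
    p.1 =ᵐ[expMeasure ν] φ ∧ p.2 =ᵐ[expMeasure ν] deriv φ}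
  zero_mem' := by
    refine ⟨fun _ => 0, contDiff_const, HasCompactSupport.zero, Lp.coeFn_zero _ _ _, ?_⟩
    rw [deriv_const']
    exact Lp.coeFn_zero _ _ _
  add_mem' := by
    rintro p q ⟨φ, h1, h2, h3, h4⟩ ⟨ψ, k1, k2, k3, k4⟩
    refine ⟨φ + ψ, h1.add k1, h2.add k2, (Lp.coeFn_add _ _).trans (h3.add k3),
      (Lp.coeFn_add _ _).trans ((h4.add k4).trans (Filter.Eventually.of_forall fun t => ?_))⟩
    exact (deriv_add (h1.differentiable (by simp) t) (k1.differentiable (by simp) t)).symm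
  smul_mem' := by
    rintro c p ⟨φ, h1, h2, h3, h4⟩
    refine ⟨fun t => c • φ t, contDiff_const.smul h1, h2.smul_left (f := fun _ => c),
      (Lp.coeFn_smul _ _).trans (h3.const_smul c),
      (Lp.coeFn_smul _ _).trans ((h4.const_smul c).trans
        (Filter.Eventually.of_forall fun t => ?_))⟩
    exact (deriv_fun_const_smul c (h1.differentiable (by simp) t)).symm

/-- (The graph of) the time derivative `∂_{0,ν}` on `H_{ν,0}(ℝ; H)`: the closure of the derivative
on `C_c^∞(ℝ; H)`. -/
def timeDeriv (ν : ℝ) (H : Type*) [NormedAddCommGroup H] [InnerProductSpace ℂ H] :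
    Submodule ℂ (HSpace ν H × HSpace ν H) :=
  (testDerivGraph ν H).topologicalClosure

/-- The graph of `(A f)(t) = A (f t)` on the simple functions `f ∈ H_{ν,0}(ℝ; H)` with values in
the domain of `A`. -/
def simpleGraph (ν : ℝ) (A : H →ₗ.[ℂ] H) : Submodule ℂ (HSpace ν H × HSpace ν H) where
  carrier := {p | ∃ s : SimpleFunc ℝ A.domain,
    p.1 =ᵐ[expMeasure ν] (fun t => (s t : H)) ∧ p.2 =ᵐ[expMeasure ν] (fun t => A (s t))}
  zero_mem' := by
    refine ⟨0, ?_, ?_⟩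
    · exact (Lp.coeFn_zero H 2 (expMeasure ν)).trans (Filter.Eventually.of_forall fun t => by simp)
    · exact (Lp.coeFn_zero H 2 (expMeasure ν)).trans (Filter.Eventually.of_forall fun t => by simp)
  add_mem' := by
    rintro p q ⟨s, h1, h2⟩ ⟨s', k1, k2⟩
    refine ⟨s + s', (Lp.coeFn_add _ _).trans ((h1.add k1).trans ?_),
      (Lp.coeFn_add _ _).trans ((h2.add k2).trans ?_)⟩
    · exact Filter.Eventually.of_forall fun t => by simp
    · exact Filter.Eventually.of_forall fun t => by simp [LinearPMap.map_add]
  smul_mem' := by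
    rintro c p ⟨s, h1, h2⟩
    refine ⟨c • s, (Lp.coeFn_smul _ _).trans ((h1.const_smul c).trans ?_),
      (Lp.coeFn_smul _ _).trans ((h2.const_smul c).trans ?_)⟩
    · exact Filter.Eventually.of_forall fun t => by simp
    · exact Filter.Eventually.of_forall fun t => by simp [LinearPMap.map_smul]

/-- (The graph of) the canonical extension to `H_{ν,0}(ℝ; H)` of an operator `A` in `H`: the closure
of the operator acting as `(A f)(t) = A (f t)` on simple functions with values in `D(A)`. -/
def extension (ν : ℝ) (A : H →ₗ.[ℂ] H) : Submodule ℂ (HSpace ν H × HSpace ν H) :=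
  (simpleGraph ν A).topologicalClosure

/-- The truncation `χ_{(-∞,a]}(m)` on `H_{ν,0}(ℝ; H)`. -/
def truncate {ν : ℝ} (a : ℝ) (f : HSpace ν H) : HSpace ν H :=
  ((Lp.memLp f).indicator (measurableSet_Iic (a := a))).toLp _

/-- `T` is causal: `χ_{(-∞,a]}(m) T χ_{(-∞,a]}(m) = χ_{(-∞,a]}(m) T` for every `a ∈ ℝ`. -/
def IsCausal {ν : ℝ} (T : HSpace ν H → HSpace ν H) : Prop :=
  ∀ (a : ℝ) (f : HSpace ν H), truncate a (T (truncate a f)) = truncate a (T f)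

end Operators

/-! ### Linear material laws -/

/-- A bounded analytic function `B_ℂ(r, r) → L(H)`; only its values on `B_ℂ(r, r)` matter. -/
structure MaterialLaw (H : Type*) [NormedAddCommGroup H] [InnerProductSpace ℂ H] (r : ℝ) where
  /-- the operator-valued function -/
  toFun : ℂ → H →L[ℂ] H
  analytic : AnalyticOnNhd ℂ toFun (Metric.ball (r : ℂ) r)
  bounded : ∃ C : ℝ, ∀ z ∈ Metric.ball (r : ℂ) r, ‖toFun z‖ ≤ C

instance {H : Type*} [NormedAddCommGroup H] [InnerProductSpace ℂ H] {r : ℝ} :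
    CoeFun (MaterialLaw H r) fun _ => ℂ → H →L[ℂ] H := ⟨MaterialLaw.toFun⟩

/-- The point `1 / (is + ν)` with `s = 2πx`. -/
def spectralPoint (ν x : ℝ) : ℂ := (Complex.I * (2 * Real.pi * x : ℝ) + ν)⁻¹

theorem spectralPoint_mem {r ν : ℝ} (hr : 0 < r) (hν : 1 / (2 * r) < ν) (x : ℝ) :
    spectralPoint ν x ∈ Metric.ball (r : ℂ) r := by
  have hν0 : 0 < ν := lt_trans (by positivity) hν
  have h1 : 1 < 2 * r * ν := by
    rw [div_lt_iff₀ (by positivity)] at hν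
    linarith
  set s : ℝ := 2 * Real.pi * x
  set w : ℂ := Complex.I * (s : ℝ) + ν with hw
  have hre : w.re = ν := by simp [hw]
  have him : w.im = s := by simp [hw]
  have hw0 : w ≠ 0 := fun h => by
    rw [h] at hre
    simp at hre
    linarith
  have key : ‖1 - (r : ℂ) * w‖ < ‖(r : ℂ) * w‖ := by
    rw [← sq_lt_sq₀ (norm_nonneg _) (norm_nonneg _), ← Complex.normSq_eq_norm_sq,
      ← Complex.normSq_eq_norm_sq, Complex.normSq_apply, Complex.normSq_apply]
    simp [hre, him]
    nlinarith
  have hpos : 0 < ‖w‖ := norm_pos_iff.2 hw0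
  have he : spectralPoint ν x - (r : ℂ) = (1 - (r : ℂ) * w) / w := by
    change w⁻¹ - (r : ℂ) = _
    field_simp
  rw [Metric.mem_ball, dist_eq_norm, he, norm_div, div_lt_iff₀ hpos]
  refine key.trans_le ?_
  rw [norm_mul, Complex.norm_real, Real.norm_of_nonneg hr.le]

theorem continuous_spectralPoint {ν : ℝ} (hν : 0 < ν) : Continuous (spectralPoint ν) := by
  unfold spectralPoint
  refine Continuous.inv₀ (by fun_prop) fun x h => ?_
  have := congrArg Complex.re h
  simp at this
  linarith

namespace MaterialLaw

variable {H : Type*} [NormedAddCommGroup H] [InnerProductSpace ℂ H] {r : ℝ}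

theorem memLp_top (M : MaterialLaw H r) (hr : 0 < r) {ν : ℝ} (hν : 1 / (2 * r) < ν) :
    MemLp (fun x : ℝ => M (spectralPoint ν x)) ∞ (volume : Measure ℝ) := by
  obtain ⟨C, hC⟩ := M.bounded
  have hν0 : 0 < ν := lt_trans (by positivity) hν
  refine memLp_top_of_bound (Continuous.aestronglyMeasurable ?_) C
    (Filter.Eventually.of_forall fun x => hC _ (spectralPoint_mem hr hν x))
  exact M.analytic.continuousOn.comp_continuous (continuous_spectralPoint hν0)
    (spectralPoint_mem hr hν)

/-- The operator `M(1/(im + ν))` on `L²(ℝ; H)`: multiplication by `x ↦ M(1/(2πix + ν))`. -/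
def mulOp (M : MaterialLaw H r) (hr : 0 < r) {ν : ℝ} (hν : 1 / (2 * r) < ν) :
    Lp H 2 (volume : Measure ℝ) →L[ℂ] Lp H 2 (volume : Measure ℝ) :=
  (ContinuousLinearMap.id ℂ (H →L[ℂ] H)).holderL volume ∞ 2 2 ((M.memLp_top hr hν).toLp _)

/-- The operator `M(∂₀⁻¹) = 𝓛_ν^* M(1/(im + ν)) 𝓛_ν` on `H_{ν,0}(ℝ; H)`, for `ν > 1/(2r)`; note that
`𝓛_ν^* = 𝓛_ν⁻¹`. -/
def op [CompleteSpace H] (M : MaterialLaw H r) (hr : 0 < r) {ν : ℝ} (hν : 1 / (2 * r) < ν) :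
    HSpace ν H →L[ℂ] HSpace ν H :=
  (fourierLaplace ν H).symm.toContinuousLinearEquiv.toContinuousLinearMap ∘L
    M.mulOp hr hν ∘L (fourierLaplace ν H).toContinuousLinearEquiv.toContinuousLinearMap

end MaterialLaw

/-- (The graph of) the operator `∂₀ M(∂₀⁻¹) + A` on `H_{ν,0}(ℝ; H)` with its natural domain: all `u`
in the domain of the extension of `A` for which `M(∂₀⁻¹) u` is in the domain of `∂₀`. -/
def evolutionOp {H : Type*} [NormedAddCommGroup H] [InnerProductSpace ℂ H] [CompleteSpace H]
    {r : ℝ} (hr : 0 < r) (M : MaterialLaw H r) (A : H →ₗ.[ℂ] H) {ν : ℝ} (hν : 1 / (2 * r) < ν) :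
    Submodule ℂ (HSpace ν H × HSpace ν H) where
  carrier := {p | ∃ v w : HSpace ν H, (M.op hr hν p.1, v) ∈ timeDeriv ν H ∧
    (p.1, w) ∈ extension ν A ∧ p.2 = v + w}
  zero_mem' := ⟨0, 0, by simp only [Prod.fst_zero, map_zero]; exact zero_mem (timeDeriv ν H), zero_mem (extension ν A), by simp⟩
  add_mem' := by
    rintro p q ⟨v, w, h1, h2, h3⟩ ⟨v', w', k1, k2, k3⟩
    refine ⟨v + v', w + w', ?_, ?_, ?_⟩
    · simpa using add_mem h1 k1
    · simpa using add_mem h2 k2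
    · rw [Prod.snd_add, h3, k3]
      abel
  smul_mem' := by
    rintro c p ⟨v, w, h1, h2, h3⟩
    refine ⟨c • v, c • w, ?_, ?_, ?_⟩
    · simpa using Submodule.smul_mem _ c h1
    · simpa using Submodule.smul_mem _ c h2
    · rw [Prod.smul_snd, h3, smul_add]

/-- The inverse `{(f, u) | (u, f) ∈ S}` of (the operator with graph) `S` is a densely defined
bounded operator. -/
structure HasDenselyDefinedBoundedInverse {X : Type*} [NormedAddCommGroup X] [NormedSpace ℂ X]
    (S : Submodule ℂ (X × X)) : Prop where
  injective : ∀ u : X, (u, 0) ∈ S → u = 0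
  dense_range : Dense {f : X | ∃ u, (u, f) ∈ S}
  bounded : ∃ C : ℝ, ∀ u f : X, (u, f) ∈ S → ‖u‖ ≤ C * ‖f‖

/-- `T` is the continuation to the whole space of the densely defined bounded inverse of `S`. -/
structure IsSolutionOperator {X : Type*} [NormedAddCommGroup X] [NormedSpace ℂ X]
    (S : Submodule ℂ (X × X)) (T : X →L[ℂ] X) : Prop where
  hasInverse : HasDenselyDefinedBoundedInverse S
  extends_inverse : ∀ u f : X, (u, f) ∈ S → T f = u

/-- `Re T ≥ c`, where `Re T = (T + T^*)/2`, i.e. `Re ⟪w, T w⟫ ≥ c ‖w‖²` for all `w`. -/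
def RePartGE {H : Type*} [NormedAddCommGroup H] [InnerProductSpace ℂ H]
    (T : H →L[ℂ] H) (c : ℝ) : Prop :=
  ∀ w : H, c * ‖w‖ ^ 2 ≤ (inner ℂ w (T w)).re

/-! ### Abstract linear control systems -/

/-- The Hilbert space direct sum `H₀ ⊕ H₁`. -/
abbrev Sum₂ (H₀ H₁ : Type*) : Type _ := WithLp 2 (H₀ × H₁)

/-- The Hilbert space direct sum `H₀ ⊕ H₁ ⊕ Y`, written as `(H₀ ⊕ H₁) ⊕ Y`. -/
abbrev StateSpace (H₀ H₁ Y : Type*) : Type _ := WithLp 2 (Sum₂ H₀ H₁ × Y)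

/-- The data of an abstract linear control system `𝒞_{M,F,B}`. -/
structure AbstractLinearControlSystem (H₀ H₁ U Y : Type*)
    [NormedAddCommGroup H₀] [InnerProductSpace ℂ H₀] [CompleteSpace H₀]
    [NormedAddCommGroup H₁] [InnerProductSpace ℂ H₁] [CompleteSpace H₁]
    [NormedAddCommGroup U] [InnerProductSpace ℂ U] [CompleteSpace U]
    [NormedAddCommGroup Y] [InnerProductSpace ℂ Y] [CompleteSpace Y] where
  /-- the radius of the ball `B_ℂ(r, r)` -/
  r : ℝ
  r_pos : 0 < r
  /-- the densely defined closed operator `F : D(F) ⊆ H₀ → H₁` -/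
  F : H₀ →ₗ.[ℂ] H₁
  F_dense : Dense (F.domain : Set H₀)
  F_closed : F.IsClosed
  /-- the linear material law `K : B_ℂ(r, r) → L(H₀ ⊕ H₁)` -/
  K : MaterialLaw (Sum₂ H₀ H₁) r
  M₁₀₂ : Y →L[ℂ] H₀
  M₁₁₂ : Y →L[ℂ] H₁
  M₁₂₀ : H₀ →L[ℂ] Y
  M₁₂₁ : H₁ →L[ℂ] Y
  M₁₂₂ : Y →L[ℂ] Y
  /-- the control operator (on each of the spaces `H_{ν,0}`) -/
  B : ∀ ν : ℝ, HSpace ν U →L[ℂ] HSpace ν (StateSpace H₀ H₁ Y)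

namespace AbstractLinearControlSystem

variable {H₀ H₁ U Y : Type*}
  [NormedAddCommGroup H₀] [InnerProductSpace ℂ H₀] [CompleteSpace H₀]
  [NormedAddCommGroup H₁] [InnerProductSpace ℂ H₁] [CompleteSpace H₁]
  [NormedAddCommGroup U] [InnerProductSpace ℂ U] [CompleteSpace U]
  [NormedAddCommGroup Y] [InnerProductSpace ℂ Y] [CompleteSpace Y]

/-- The pairing of `S : E → H₀` and `T : E → H₁` to the column `E → H₀ ⊕ H₁`. -/
def column {E G₀ G₁ : Type*} [NormedAddCommGroup E] [InnerProductSpace ℂ E]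
    [NormedAddCommGroup G₀] [InnerProductSpace ℂ G₀]
    [NormedAddCommGroup G₁] [InnerProductSpace ℂ G₁]
    (S : E →L[ℂ] G₀) (T : E →L[ℂ] G₁) : E →L[ℂ] WithLp 2 (G₀ × G₁) :=
  (WithLp.prodContinuousLinearEquiv 2 ℂ G₀ G₁).symm.toContinuousLinearMap ∘L S.prod T

/-- The block operator `[[P, Q], [R, S]]` on `G₀ ⊕ G₁`. -/
def block {G₀ G₁ : Type*} [NormedAddCommGroup G₀] [InnerProductSpace ℂ G₀]
    [NormedAddCommGroup G₁] [InnerProductSpace ℂ G₁]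
    (P : G₀ →L[ℂ] G₀) (Q : G₁ →L[ℂ] G₀) (R : G₀ →L[ℂ] G₁) (S : G₁ →L[ℂ] G₁) :
    WithLp 2 (G₀ × G₁) →L[ℂ] WithLp 2 (G₀ × G₁) :=
  column (P ∘L WithLp.fstL 2 ℂ G₀ G₁ + Q ∘L WithLp.sndL 2 ℂ G₀ G₁)
    (R ∘L WithLp.fstL 2 ℂ G₀ G₁ + S ∘L WithLp.sndL 2 ℂ G₀ G₁)

variable (𝒞 : AbstractLinearControlSystem H₀ H₁ U Y)

/-- The constant part `[[0, (M₁₀₂; M₁₁₂)], [(M₁₂₀ M₁₂₁), M₁₂₂]]` of the material law. -/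
def M₁ : StateSpace H₀ H₁ Y →L[ℂ] StateSpace H₀ H₁ Y :=
  block 0 (column 𝒞.M₁₀₂ 𝒞.M₁₁₂)
    (𝒞.M₁₂₀ ∘L WithLp.fstL 2 ℂ H₀ H₁ + 𝒞.M₁₂₁ ∘L WithLp.sndL 2 ℂ H₀ H₁) 𝒞.M₁₂₂

/-- The block operator `[[T, 0], [0, 0]]` on `(H₀ ⊕ H₁) ⊕ Y`, as a linear map in `T`. -/
def corner (G Y : Type*) [NormedAddCommGroup G] [InnerProductSpace ℂ G]
    [NormedAddCommGroup Y] [InnerProductSpace ℂ Y] :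
    (G →L[ℂ] G) →L[ℂ] (WithLp 2 (G × Y) →L[ℂ] WithLp 2 (G × Y)) :=
  (ContinuousLinearMap.compL ℂ (WithLp 2 (G × Y)) G (WithLp 2 (G × Y))
    (column (ContinuousLinearMap.id ℂ G) 0)) ∘L
  ((ContinuousLinearMap.compL ℂ (WithLp 2 (G × Y)) G G).flip (WithLp.fstL 2 ℂ G Y))

theorem corner_apply {G Y : Type*} [NormedAddCommGroup G] [InnerProductSpace ℂ G]
    [NormedAddCommGroup Y] [InnerProductSpace ℂ Y] (T : G →L[ℂ] G) :
    corner G Y T = block T 0 0 0 := by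
  ext w
  simp [corner, block, column]

/-- The material law `M(z) = [[K(z), 0], [0, 0]] + z M₁` of the control system. -/
def M : MaterialLaw (StateSpace H₀ H₁ Y) 𝒞.r where
  toFun z := block (𝒞.K z) 0 0 0 + z • 𝒞.M₁
  analytic := by
    simp_rw [← corner_apply]
    refine AnalyticOnNhd.add ?_ (analyticOnNhd_id.smul analyticOnNhd_const)
    exact (corner (Sum₂ H₀ H₁) Y).comp_analyticOnNhd 𝒞.K.analytic
  bounded := by
    obtain ⟨C, hC⟩ := 𝒞.K.bounded
    refine ⟨‖corner (Sum₂ H₀ H₁) Y‖ * C + 2 * 𝒞.r * ‖𝒞.M₁‖, fun z hz => ?_⟩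
    simp_rw [← corner_apply]
    have hz' : ‖z‖ ≤ 2 * 𝒞.r := by
      rw [Metric.mem_ball, dist_eq_norm] at hz
      have h := norm_add_le (z - (𝒞.r : ℂ)) (𝒞.r : ℂ)
      rw [sub_add_cancel, Complex.norm_real, Real.norm_of_nonneg 𝒞.r_pos.le] at h
      linarith
    refine (norm_add_le _ _).trans (add_le_add ?_ ?_)
    · exact (ContinuousLinearMap.le_opNorm _ _).trans
        (mul_le_mul_of_nonneg_left (hC z hz) (norm_nonneg _))
    · rw [norm_smul]
      exact mul_le_mul_of_nonneg_right hz' (norm_nonneg _)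

/-- The operator `A = [[0, F^*, 0], [-F, 0, 0], [0, 0, 0]]` in `H₀ ⊕ H₁ ⊕ Y` with domain
`D(F) ⊕ D(F^*) ⊕ Y`. -/
def A : StateSpace H₀ H₁ Y →ₗ.[ℂ] StateSpace H₀ H₁ Y where
  domain :=
    { carrier := {w | w.fst.fst ∈ 𝒞.F.domain ∧ w.fst.snd ∈ 𝒞.F.adjoint.domain}
      zero_mem' := ⟨zero_mem _, zero_mem _⟩
      add_mem' := fun h k => ⟨add_mem h.1 k.1, add_mem h.2 k.2⟩
      smul_mem' := fun c _ h => ⟨Submodule.smul_mem _ c h.1, Submodule.smul_mem _ c h.2⟩ }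
  toFun :=
    { toFun := fun w => WithLp.toLp 2
        (WithLp.toLp 2 (𝒞.F.adjoint ⟨w.1.fst.snd, w.2.2⟩, -𝒞.F ⟨w.1.fst.fst, w.2.1⟩), 0)
      map_add' := fun w w' => by
        have h1 := 𝒞.F.adjoint.map_add ⟨w.1.fst.snd, w.2.2⟩ ⟨w'.1.fst.snd, w'.2.2⟩
        have h2 := 𝒞.F.map_add ⟨w.1.fst.fst, w.2.1⟩ ⟨w'.1.fst.fst, w'.2.1⟩
        refine WithLp.ofLp_injective 2 (Prod.ext (WithLp.ofLp_injective 2 (Prod.ext ?_ ?_)) ?_)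
        · exact h1
        · exact (congrArg Neg.neg h2).trans (neg_add _ _)
        · exact (add_zero (0 : Y)).symm
      map_smul' := fun c w => by
        have h1 := 𝒞.F.adjoint.map_smul c ⟨w.1.fst.snd, w.2.2⟩
        have h2 := 𝒞.F.map_smul c ⟨w.1.fst.fst, w.2.1⟩
        refine WithLp.ofLp_injective 2 (Prod.ext (WithLp.ofLp_injective 2 (Prod.ext ?_ ?_)) ?_)
        · exact h1
        · exact (congrArg Neg.neg h2).trans (smul_neg c _).symm
        · exact (smul_zero c).symm }

/-- (The graph of) the operator `∂₀ M(∂₀⁻¹) + A` of the control system on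
`H_{ν,0}(ℝ; H₀ ⊕ H₁ ⊕ Y)`, for `ν > 1/(2r)`. -/
def systemOp {ν : ℝ} (hν : 1 / (2 * 𝒞.r) < ν) :
    Submodule ℂ (HSpace ν (StateSpace H₀ H₁ Y) × HSpace ν (StateSpace H₀ H₁ Y)) :=
  evolutionOp 𝒞.r_pos 𝒞.M 𝒞.A hν

/-- The control system is well-posed: for all sufficiently large `ν` the operator
`∂₀ M(∂₀⁻¹) + A` possesses a densely defined bounded inverse. -/
def WellPosed : Prop :=
  ∃ ν₀ : ℝ, ∀ (ν : ℝ) (hν : 1 / (2 * 𝒞.r) < ν), ν₀ ≤ ν →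
    HasDenselyDefinedBoundedInverse (𝒞.systemOp hν)

/-- The operator `J = ½ (M₁₀₂ + M₁₂₀^*; M₁₁₂ + M₁₂₁^*) ∈ L(Y; H₀ ⊕ H₁)`. -/
def J : Y →L[ℂ] Sum₂ H₀ H₁ :=
  (1 / 2 : ℂ) • column (𝒞.M₁₀₂ + 𝒞.M₁₂₀.adjoint) (𝒞.M₁₁₂ + 𝒞.M₁₂₁.adjoint)

end AbstractLinearControlSystem

end ControlSystems

end

/-! On the Fourier–Laplace side the equation decouples: at z = 1/(is + ν) it reads (z⁻¹M(z) + A)w =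
f. The factor z in front of the constant part of M cancels, and Young's inequality with weight δ
absorbs the off-diagonal entries. Thus Re z⁻¹M(z) ≥ c, where c is the smaller of c₀ - δ‖J‖ and c₁ -
‖J‖/δ (`rePartGE_inv_smul_M`).

Since A is skew-selfadjoint, N + A is invertible for every bounded N with Re N ≥ c > 0, with inverse
of norm at most 1/c (`IsSkewResolvent.isUnit`, `resolventAt_norm_le`). With R = (1 + A)⁻¹ this
inverse is R(1 + (N - 1)R)⁻¹, which involves bounded operators only and depends analytically on N.
Hence S(z) = (z⁻¹M(z) + A)⁻¹ is itself a linear material law, and S(∂₀⁻¹) is the solution operator.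
To check this, membership in the graphs of ∂₀ and A is rewritten as an equation between bounded
operators (`mem_timeDeriv_iff`, `mem_extension_iff`).

Causality then follows from that of every linear material law (`MaterialLaw.isCausal_op`). An energy
estimate gives it for ∂₀⁻¹, hence for polynomials in ∂₀⁻¹ with operator coefficients. Taylor
expansion about r reaches the contracted laws M(r + ρ(z - r)) with ρ < 1, and letting ρ → 1 reaches
M. Strong limits preserve causality, so bounded pointwise convergence of symbols is enough
(`HasSymbol.tendsto`). -/

noncomputable section

namespace ControlSystems

/-! ### Fourier–Laplace multipliers -/

section Symbols

variable {H : Type*} [NormedAddCommGroup H] [InnerProductSpace ℂ H] [CompleteSpace H] {ν : ℝ}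

/-- `T` acts on the Fourier–Laplace side as multiplication by the operator-valued function `m`. -/
def HasSymbol (T : HSpace ν H →L[ℂ] HSpace ν H) (m : ℝ → H →L[ℂ] H) : Prop :=
  ∀ f, fourierLaplace ν H (T f) =ᵐ[volume] fun x => m x (fourierLaplace ν H f x)

namespace HasSymbol

variable {T T' : HSpace ν H →L[ℂ] HSpace ν H} {m m' : ℝ → H →L[ℂ] H}

theorem add (h : HasSymbol T m) (h' : HasSymbol T' m') : HasSymbol (T + T') (m + m') := by
  intro f
  rw [add_apply, map_add]
  filter_upwards [Lp.coeFn_add (fourierLaplace ν H (T f)) (fourierLaplace ν H (T' f)), h f, h' f]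
    with x h1 h2 h3
  rw [h1, Pi.add_apply, h2, h3]
  rfl

theorem comp (h : HasSymbol T m) (h' : HasSymbol T' m') :
    HasSymbol (T ∘L T') (fun x => m x ∘L m' x) := by
  intro f
  filter_upwards [h (T' f), h' f] with x h1 h2
  simp [h1, h2]

theorem zero : HasSymbol (0 : HSpace ν H →L[ℂ] HSpace ν H) 0 := by
  intro f
  rw [zero_apply, map_zero]
  exact (Lp.coeFn_zero H 2 (volume : Measure ℝ)).trans (Filter.Eventually.of_forall fun x => rfl)

/-- Bounded pointwise convergence of symbols yields strong convergence of the operators. -/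
theorem tendsto {T : ℕ → HSpace ν H →L[ℂ] HSpace ν H} {m : ℕ → ℝ → H →L[ℂ] H}
    {T₀ : HSpace ν H →L[ℂ] HSpace ν H} {m₀ : ℝ → H →L[ℂ] H} (h : ∀ n, HasSymbol (T n) (m n))
    (h₀ : HasSymbol T₀ m₀) {C : ℝ} (hm : ∀ n x, ‖m n x‖ ≤ C)
    (hlim : ∀ x, Filter.Tendsto (fun n => m n x) Filter.atTop (nhds (m₀ x))) (f : HSpace ν H) :
    Filter.Tendsto (fun n => T n f) Filter.atTop (nhds (T₀ f)) := by
  have hm₀ : ∀ x, ‖m₀ x‖ ≤ C := fun x =>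
    le_of_tendsto (hlim x).norm (Filter.Eventually.of_forall fun n => hm n x)
  refine ((fourierLaplace ν H).toHomeomorph.isInducing.tendsto_nhds_iff).2 ?_
  refine (Lp.tendsto_Lp_iff_tendsto_eLpNorm' _ _).2 ?_
  have hdiff : ∀ n, ⇑(fourierLaplace ν H (T n f)) - ⇑(fourierLaplace ν H (T₀ f)) =ᵐ[volume]
      fun x => (m n x - m₀ x) (fourierLaplace ν H f x) := by
    intro n
    filter_upwards [h n f, h₀ f] with x h1 h2
    rw [Pi.sub_apply, h1, h2]
    rfl
  set g := fourierLaplace ν H f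
  -- Dominated convergence for the squared norms: the majorant (2C‖g‖)² is integrable because g is
  -- in L².
  have hlint : Filter.Tendsto
      (fun n => ∫⁻ x, ‖(⇑(fourierLaplace ν H (T n f)) - ⇑(fourierLaplace ν H (T₀ f))) x‖ₑ ^ (2 : ℝ))
      Filter.atTop (nhds (∫⁻ _ : ℝ, 0)) := by
    refine tendsto_lintegral_of_dominated_convergence'
      (fun x => (ENNReal.ofReal (C + C) * ‖g x‖ₑ) ^ (2 : ℝ)) (fun n => ?_) (fun n => ?_) ?_ ?_
    · exact (((Lp.aestronglyMeasurable _).sub (Lp.aestronglyMeasurable _)).enorm).pow_const _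
    · filter_upwards [hdiff n] with x hx
      rw [hx]
      gcongr
      rw [← ofReal_norm, ← ofReal_norm, ← ENNReal.ofReal_mul' (norm_nonneg _)]
      exact ENNReal.ofReal_le_ofReal (ContinuousLinearMap.le_of_opNorm_le _
        ((norm_sub_le _ _).trans (add_le_add (hm n x) (hm₀ x))) _)
    · have h2 : ∫⁻ x, ‖g x‖ₑ ^ (2 : ℝ) < ∞ := by
        have := lintegral_rpow_enorm_lt_top_of_eLpNorm_lt_top (p := 2) (by norm_num) (by norm_num)
          (Lp.eLpNorm_lt_top g)
        simpa using this
      simp_rw [ENNReal.mul_rpow_of_nonneg _ _ (by norm_num : (0 : ℝ) ≤ 2)]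
      rw [lintegral_const_mul' _ _ (by simp)]
      exact (ENNReal.mul_lt_top (by simp) h2).ne
    · filter_upwards [ae_all_iff.2 hdiff] with x hx
      simp_rw [hx]
      have h0 : Filter.Tendsto (fun n => (m n x - m₀ x) (g x)) Filter.atTop (nhds 0) := by
        have := (((ContinuousLinearMap.apply ℂ H (g x)).continuous.tendsto _).comp (hlim x)).sub_const
          (m₀ x (g x))
        simpa [Function.comp_def] using this
      have := (ENNReal.continuous_rpow_const (y := 2)).tendsto _ |>.comp h0.enorm
      simpa [Function.comp_def] using this
  have := (ENNReal.continuous_rpow_const (y := 1 / 2)).tendsto _ |>.comp hlint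
  simpa [eLpNorm_eq_lintegral_rpow_enorm_toReal, Function.comp_def] using this

end HasSymbol

omit [CompleteSpace H] in
theorem MaterialLaw.mulOp_ae {r : ℝ} (M : MaterialLaw H r) (hr : 0 < r) (hν : 1 / (2 * r) < ν)
    (f : Lp H 2 (volume : Measure ℝ)) :
    M.mulOp hr hν f =ᵐ[volume] fun x => M (spectralPoint ν x) (f x) := by
  rw [MaterialLaw.mulOp, ContinuousLinearMap.holderL_apply_apply]
  refine (ContinuousLinearMap.coeFn_holder _ _ _).trans ?_
  filter_upwards [(M.memLp_top hr hν).coeFn_toLp] with x hx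
  simp [hx]

theorem MaterialLaw.hasSymbol_op {r : ℝ} (M : MaterialLaw H r) (hr : 0 < r)
    (hν : 1 / (2 * r) < ν) :
    HasSymbol (M.op hr hν) (fun x => M (spectralPoint ν x)) := by
  intro f
  have h : fourierLaplace ν H (M.op hr hν f) = M.mulOp hr hν (fourierLaplace ν H f) :=
    (fourierLaplace ν H).apply_symm_apply _
  rw [h]
  exact M.mulOp_ae hr hν _

/-- The Fourier transform commutes with constant operators. -/
theorem fourierTransform_compLp (L : H →L[ℂ] H) (f : Lp H 2 (volume : Measure ℝ)) :
    Lp.fourierTransformₗᵢ ℝ H (L.compLp f) = L.compLp (Lp.fourierTransformₗᵢ ℝ H f) := by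
  have hd : DenseRange (SchwartzMap.toLpCLM ℝ (E := ℝ) H 2 volume) :=
    SchwartzMap.denseRange_toLpCLM ENNReal.ofNat_ne_top
  have key : ∀ φ : SchwartzMap ℝ H, L.compLp (φ.toLp 2) =
      (SchwartzMap.postcompCLM L φ).toLp 2 (volume : Measure ℝ) := by
    intro φ
    apply Lp.ext
    filter_upwards [L.coeFn_compLp (φ.toLp 2), φ.coeFn_toLp 2 volume,
      (SchwartzMap.postcompCLM L φ).coeFn_toLp 2 volume] with x h1 h2 h3
    rw [h1, h2, h3]
    rfl
  -- Both sides are continuous in f, so Schwartz functions suffice; for them L passes under the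
  -- Fourier integral.
  refine hd.induction_on (p := fun f : Lp H 2 (volume : Measure ℝ) =>
    Lp.fourierTransformₗᵢ ℝ H (L.compLp f) = L.compLp (Lp.fourierTransformₗᵢ ℝ H f)) f ?_ ?_
  · exact isClosed_eq ((Lp.fourierTransformₗᵢ ℝ H).continuous.comp
      (L.compLpL 2 volume).continuous)
      ((L.compLpL 2 volume).continuous.comp (Lp.fourierTransformₗᵢ ℝ H).continuous)
  · intro φ
    change FourierTransform.fourier (L.compLp (φ.toLp 2)) =
      L.compLp (FourierTransform.fourier (φ.toLp 2))
    rw [SchwartzMap.toLp_fourier_eq, key, key, SchwartzMap.toLp_fourier_eq]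
    congr 1
    ext x
    change FourierTransform.fourier (fun t => L (φ t)) x = L (FourierTransform.fourier (φ : ℝ → H) x)
    rw [Real.fourier_eq, Real.fourier_eq, ← L.integral_comp_comm]
    · simp [Circle.smul_def]
    · exact (Real.fourierIntegral_convergent_iff x).2 φ.integrable

/-- A constant operator, acting pointwise on `H_{ν,0}(ℝ; H)`. -/
abbrev constOp (ν : ℝ) (L : H →L[ℂ] H) : HSpace ν H →L[ℂ] HSpace ν H :=
  L.compLpL 2 (expMeasure ν)

omit [CompleteSpace H] in
theorem expMul_ae (f : HSpace ν H) :
    expMul ν H f =ᵐ[volume] fun t => (Real.exp (-ν * t) : ℂ) • f t :=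
  MemLp.coeFn_toLp (memLp_expMul (Lp.memLp f))

theorem hasSymbol_constOp (L : H →L[ℂ] H) : HasSymbol (constOp ν L) (fun _ => L) := by
  intro f
  have h : expMul ν H (constOp ν L f) = L.compLp (expMul ν H f) := by
    apply Lp.ext
    filter_upwards [expMul_ae (constOp ν L f), L.coeFn_compLp (expMul ν H f), expMul_ae f,
      (ac_expMeasure ν).ae_le (L.coeFn_compLpL f)] with t h1 h2 h3 h4
    rw [h1, h2, h3, h4, map_smul]
  have h' : fourierLaplace ν H (constOp ν L f) = L.compLp (fourierLaplace ν H f) := by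
    change Lp.fourierTransformₗᵢ ℝ H (expMul ν H (constOp ν L f)) = _
    rw [h, fourierTransform_compLp]
    rfl
  rw [h']
  exact L.coeFn_compLp _

end Symbols

/-! ### Accretive perturbations of a skew-selfadjoint operator -/

section Resolvent

variable {H : Type*} [NormedAddCommGroup H] [InnerProductSpace ℂ H] [CompleteSpace H]

/-- `R` is the resolvent `(1 + A)⁻¹` of a skew-selfadjoint operator `A`. -/
structure IsSkewResolvent (A : H →ₗ.[ℂ] H) (R : H →L[ℂ] H) : Prop where
  mem_domain : ∀ x, R x ∈ A.domain
  apply_add : ∀ x (h : R x ∈ A.domain), R x + A ⟨R x, h⟩ = x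
  left_inv : ∀ p : A.domain, R (p + A p) = p
  -- With u = R x and x = u + A u this says Re ⟨u, A u⟩ = 0. The next field is the trace of
  -- normality of R that is needed to treat the adjoint.
  re_inner : ∀ x, (inner ℂ (R x) x).re = ‖R x‖ ^ 2
  norm_adjoint : ∀ x, ‖R.adjoint x‖ = ‖R x‖

/-- For `R = (1 + A)⁻¹`, the operator `(N + A)(1 + A)⁻¹ = 1 + (N - 1)R`. -/
def pencil (R N : H →L[ℂ] H) : H →L[ℂ] H := 1 + (N - 1) * R

omit [CompleteSpace H] in
theorem pencil_apply (R N : H →L[ℂ] H) (y : H) : pencil R N y = y + (N - 1) (R y) := rfl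

/-- For `R = (1 + A)⁻¹`, the operator `(N + A)⁻¹`. -/
def resolventAt (R N : H →L[ℂ] H) : H →L[ℂ] H := R ∘L Ring.inverse (pencil R N)

namespace IsSkewResolvent

variable {A : H →ₗ.[ℂ] H} {R : H →L[ℂ] H}

/-- For u = R y one has y = (1 + A)u, so the right-hand vector is (N + A)u. As Re ⟨u, A u⟩ = 0,
pairing it with u leaves Re ⟨u, N u⟩ ≥ c‖u‖², and Cauchy–Schwarz finishes. -/
theorem norm_apply_le (hR : IsSkewResolvent A R) {N : H →L[ℂ] H} {c : ℝ}
    (hN : RePartGE N c) (y : H) : c * ‖R y‖ ≤ ‖y + (N - 1) (R y)‖ := by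
  rcases eq_or_ne (R y) 0 with h0 | h0
  · simp [h0]
  have hpos : 0 < ‖R y‖ := norm_pos_iff.2 h0
  have h1 : (inner ℂ (R y) (y + (N - 1) (R y))).re = (inner ℂ (R y) (N (R y))).re := by
    have h3 : inner ℂ (R y) (R y) = ((‖R y‖ ^ 2 : ℝ) : ℂ) := by
      simp [inner_self_eq_norm_sq_to_K]
    rw [sub_apply, one_apply_eq_self, inner_add_right, inner_sub_right, Complex.add_re,
      Complex.sub_re, hR.re_inner, h3, Complex.ofReal_re]
    ring
  have h2 := (hN (R y)).trans (h1 ▸ (Complex.re_le_norm _).trans (norm_inner_le_norm _ _))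
  nlinarith

/-- For accretive bounded `N`, the operator `(N + A)(1 + A)⁻¹` is invertible. -/
theorem isUnit (hR : IsSkewResolvent A R) {N : H →L[ℂ] H} {c : ℝ} (hc : 0 < c)
    (hN : RePartGE N c) : IsUnit (pencil R N) := by
  set E : H →L[ℂ] H := pencil R N with hE
  have hEy : ∀ y, E y = y + (N - 1) (R y) := fun y => rfl
  -- E is bounded below: y = E y - (N - 1)R y, and R y is controlled by E y. So the range is closed,
  -- and it remains to see that its orthogonal complement, the kernel of E*, is trivial.
  have hbound : ∀ y, ‖y‖ ≤ (1 + ‖N - 1‖ / c) * ‖E y‖ := by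
    intro y
    have h1 := hR.norm_apply_le hN y
    rw [← hEy] at h1
    have h2 : y = E y - (N - 1) (R y) := by rw [hEy]; abel
    have h3 : ‖R y‖ ≤ ‖E y‖ / c := by rw [le_div_iff₀ hc]; linarith
    calc ‖y‖ = ‖E y - (N - 1) (R y)‖ := by rw [← h2]
      _ ≤ ‖E y‖ + ‖(N - 1) (R y)‖ := norm_sub_le _ _
      _ ≤ ‖E y‖ + ‖N - 1‖ * (‖E y‖ / c) := by
        gcongr
        exact (N - 1).le_of_opNorm_le_of_le le_rfl h3
      _ = _ := by ring
  have hanti : AntilipschitzWith (Real.toNNReal (1 + ‖N - 1‖ / c)) E := by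
    refine E.antilipschitz_of_bound fun y => ?_
    rw [Real.coe_toNNReal _ (by positivity)]
    exact hbound y
  have hclosed : IsClosed (E.range : Set H) := hanti.isClosed_range E.uniformContinuous
  have hperp : E.rangeᗮ = ⊥ := by
    rw [Submodule.eq_bot_iff]
    intro h hh
    have hadj : E.adjoint h = 0 := by
      refine ext_inner_left ℂ fun y => ?_
      rw [ContinuousLinearMap.adjoint_inner_right, inner_zero_right]
      exact hh _ ⟨y, rfl⟩
    -- E* = 1 + R*(N* - 1), so E* h = 0 says h = R* k for this k.
    set k := h - N.adjoint h with hk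
    have h1 : h = R.adjoint k := by
      have : E.adjoint h = h - R.adjoint k := by
        rw [hE, hk, pencil, ← ContinuousLinearMap.star_eq_adjoint, star_add, star_mul, star_sub,
          star_one, ← ContinuousLinearMap.star_eq_adjoint, ← ContinuousLinearMap.star_eq_adjoint]
        change h + star R (star N h - h) = _
        rw [map_sub, map_sub]
        abel
      rw [this, sub_eq_zero] at hadj
      exact hadj
    -- ⟨h, N h⟩ = ⟨h - k, h⟩, and Re ⟨k, h⟩ = Re ⟨R k, k⟩ = ‖R k‖² = ‖R* k‖² = ‖h‖². Accretivity of
    -- N then forces h = 0.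
    have h2 : (inner ℂ h (N h)).re = 0 := by
      rw [← ContinuousLinearMap.adjoint_inner_left, show N.adjoint h = h - k by rw [hk]; abel,
        inner_sub_left]
      have h3 : inner ℂ h h = ((‖h‖ ^ 2 : ℝ) : ℂ) := by
        simp [inner_self_eq_norm_sq_to_K]
      have h4 : inner ℂ k h = inner ℂ (R k) k := by
        conv_lhs => rw [h1]
        rw [ContinuousLinearMap.adjoint_inner_right]
      rw [Complex.sub_re, h3, h4, hR.re_inner, ← hR.norm_adjoint, ← h1, Complex.ofReal_re, sub_self]
    have h5 := hN h
    rw [h2] at h5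
    have h6 : ‖h‖ ^ 2 ≤ 0 := by nlinarith [sq_nonneg ‖h‖]
    exact norm_eq_zero.1 (pow_eq_zero_iff two_ne_zero |>.1 (le_antisymm h6 (sq_nonneg _)))
  have hrange : E.range = ⊤ := by
    have : CompleteSpace E.range := hclosed.completeSpace_coe
    exact Submodule.orthogonal_eq_bot_iff.1 hperp
  rw [ContinuousLinearMap.isUnit_iff_bijective]
  exact ⟨hanti.injective, LinearMap.range_eq_top.1 hrange⟩

theorem resolventAt_norm_le (hR : IsSkewResolvent A R) {N : H →L[ℂ] H} {c : ℝ} (hc : 0 < c)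
    (hN : RePartGE N c) : ‖resolventAt R N‖ ≤ c⁻¹ := by
  refine ContinuousLinearMap.opNorm_le_bound _ (by positivity) fun x => ?_
  have h1 := hR.norm_apply_le hN (Ring.inverse (pencil R N) x)
  have h2 := congrArg (fun T : H →L[ℂ] H => T x)
    (Ring.mul_inverse_cancel _ (hR.isUnit hc hN))
  change _ + (N - 1) (R (Ring.inverse (pencil R N) x)) = x at h2
  rw [show Ring.inverse (pencil R N) x + (N - 1) (R (Ring.inverse (pencil R N) x)) = x
    from h2] at h1
  rw [inv_mul_eq_div, le_div_iff₀ hc, mul_comm]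
  exact h1

/-- `(N + A)⁻¹` is a left inverse of `N + A`. -/
theorem resolventAt_left_inv (hR : IsSkewResolvent A R) {N : H →L[ℂ] H} {c : ℝ} (hc : 0 < c)
    (hN : RePartGE N c) {u w : H} (h : R (u + w) = u) : resolventAt R N (N u + w) = u := by
  -- The hypothesis `h` encodes that u is in D(A) with A u = w.
  have h1 : pencil R N (u + w) = N u + w := by
    rw [pencil_apply, h, sub_apply, one_apply_eq_self]
    abel
  have h2 := congrArg (fun T : H →L[ℂ] H => T (u + w))
    (Ring.inverse_mul_cancel _ (hR.isUnit hc hN))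
  change Ring.inverse (pencil R N) ((pencil R N) (u + w)) = u + w at h2
  rw [resolventAt, ContinuousLinearMap.comp_apply, ← h1, h2, h]

/-- `(N + A)⁻¹` is a right inverse of `N + A`. -/
theorem resolventAt_right_inv (hR : IsSkewResolvent A R) {N : H →L[ℂ] H} {c : ℝ} (hc : 0 < c)
    (hN : RePartGE N c) (g : H) :
    R (resolventAt R N g + (g - N (resolventAt R N g))) = resolventAt R N g := by
  set y := Ring.inverse (pencil R N) g with hy
  have h2 : y + (N - 1) (R y) = g := congrArg (fun T : H →L[ℂ] H => T g)
    (Ring.mul_inverse_cancel _ (hR.isUnit hc hN))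
  change R (R y + (g - N (R y))) = R y
  congr 1
  rw [← h2, sub_apply, one_apply_eq_self]
  abel

/-- Inversion is analytic at the units of a Banach algebra, and the pencil depends affinely on N;
the unbounded operator A never enters. -/
theorem resolventAt_analyticOnNhd (hR : IsSkewResolvent A R) {N : ℂ → H →L[ℂ] H} {c : ℝ}
    (hc : 0 < c) {s : Set ℂ} (hN : ∀ z ∈ s, RePartGE (N z) c) (hana : AnalyticOnNhd ℂ N s) :
    AnalyticOnNhd ℂ (fun z => resolventAt R (N z)) s := by
  intro z hz
  have h1 : AnalyticAt ℂ (fun z => pencil R (N z)) z := by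
    refine analyticAt_const.add ?_
    exact (((ContinuousLinearMap.compL ℂ H H H).flip R).analyticAt _).comp
      ((hana z hz).sub analyticAt_const)
  obtain ⟨E, hE⟩ := hR.isUnit hc (hN z hz)
  have h2 : AnalyticAt ℂ (fun z => Ring.inverse (pencil R (N z))) z :=
    AnalyticAt.fun_comp (hE ▸ analyticAt_inverse E) h1
  exact ((ContinuousLinearMap.compL ℂ H H H R).analyticAt _).comp h2

end IsSkewResolvent

end Resolvent

/-! ### The block operator A is skew-selfadjoint -/

namespace AbstractLinearControlSystem

variable {H₀ H₁ U Y : Type*}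
  [NormedAddCommGroup H₀] [InnerProductSpace ℂ H₀] [CompleteSpace H₀]
  [NormedAddCommGroup H₁] [InnerProductSpace ℂ H₁] [CompleteSpace H₁]
  [NormedAddCommGroup U] [InnerProductSpace ℂ U] [CompleteSpace U]
  [NormedAddCommGroup Y] [InnerProductSpace ℂ Y] [CompleteSpace Y]
  (𝒞 : AbstractLinearControlSystem H₀ H₁ U Y)

/-- The isometric involution `(u, v, y) ↦ (u, -v, y)`. -/
def flipSign (H₀ H₁ Y : Type*)
    [NormedAddCommGroup H₀] [InnerProductSpace ℂ H₀]
    [NormedAddCommGroup H₁] [InnerProductSpace ℂ H₁]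
    [NormedAddCommGroup Y] [InnerProductSpace ℂ Y] :
    StateSpace H₀ H₁ Y ≃ₗᵢ[ℂ] StateSpace H₀ H₁ Y where
  toFun w := WithLp.toLp 2 (WithLp.toLp 2 (w.fst.fst, -w.fst.snd), w.snd)
  invFun w := WithLp.toLp 2 (WithLp.toLp 2 (w.fst.fst, -w.fst.snd), w.snd)
  left_inv w := by
    simp only [WithLp.toLp_fst, WithLp.toLp_snd, neg_neg]
    rfl
  right_inv w := by
    simp only [WithLp.toLp_fst, WithLp.toLp_snd, neg_neg]
    rfl
  map_add' w w' := by
    refine WithLp.ofLp_injective 2 (Prod.ext (WithLp.ofLp_injective 2 (Prod.ext ?_ ?_)) ?_)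
    · rfl
    · exact neg_add _ _
    · rfl
  map_smul' c w := by
    refine WithLp.ofLp_injective 2 (Prod.ext (WithLp.ofLp_injective 2 (Prod.ext ?_ ?_)) ?_)
    · rfl
    · exact (smul_neg _ _).symm
    · rfl
  norm_map' w := by
    simp [WithLp.prod_norm_eq_of_L2]

/-- The closed subspace `G(F) ⊕ Y` of `H₀ ⊕ H₁ ⊕ Y`, where `G(F)` is the graph of `F`. -/
def graphSubspace : Submodule ℂ (StateSpace H₀ H₁ Y) :=
  𝒞.F.graph.comap ((WithLp.linearEquiv 2 ℂ (H₀ × H₁)).toLinearMap ∘ₗ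
    (WithLp.fstL 2 ℂ (Sum₂ H₀ H₁) Y).toLinearMap)

theorem mem_graphSubspace {w : StateSpace H₀ H₁ Y} :
    w ∈ 𝒞.graphSubspace ↔ (w.fst.fst, w.fst.snd) ∈ 𝒞.F.graph := Iff.rfl

theorem isClosed_graphSubspace : IsClosed (𝒞.graphSubspace : Set (StateSpace H₀ H₁ Y)) := by
  have h : Continuous fun w : StateSpace H₀ H₁ Y => (w.fst.fst, w.fst.snd) := by fun_prop
  exact IsClosed.preimage h 𝒞.F_closed

instance : 𝒞.graphSubspace.HasOrthogonalProjection :=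
  haveI : CompleteSpace 𝒞.graphSubspace := 𝒞.isClosed_graphSubspace.completeSpace_coe
  inferInstance

/-- Orthogonality of (u, v, y) to G(F) ⊕ Y means y = 0 and ⟨x, u⟩ + ⟨F x, v⟩ = 0 for all x in D(F),
which is the definition of F*(-v) = u. -/
theorem mem_graphSubspace_orthogonal {w : StateSpace H₀ H₁ Y} (hw : w ∈ 𝒞.graphSubspaceᗮ) :
    w.snd = 0 ∧ ∃ h : -w.fst.snd ∈ 𝒞.F.adjoint.domain,
      𝒞.F.adjoint ⟨-w.fst.snd, h⟩ = w.fst.fst := by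
  have key : ∀ (u : 𝒞.F.domain) (y : Y),
      inner ℂ (u : H₀) w.fst.fst + inner ℂ (𝒞.F u) w.fst.snd + inner ℂ y w.snd = 0 := by
    intro u y
    have := hw (WithLp.toLp 2 (WithLp.toLp 2 ((u : H₀), 𝒞.F u), y))
      (𝒞.mem_graphSubspace.2 (𝒞.F.mem_graph u))
    simpa [WithLp.prod_inner_apply] using this
  refine ⟨?_, ?_⟩
  · have := key 0 w.snd
    simpa using this
  · have h2 : ((-w.fst.snd, w.fst.fst) : H₁ × H₀) ∈ 𝒞.F.adjoint.graph := by
      rw [LinearPMap.adjoint_graph_eq_graph_adjoint 𝒞.F_dense, Submodule.mem_adjoint_iff]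
      intro a b hab
      obtain ⟨u, rfl, rfl⟩ := (LinearPMap.mem_graph_iff _).1 hab
      have := key u 0
      rw [inner_zero_left, add_zero] at this
      rw [inner_neg_right]
      linear_combination -this
    obtain ⟨v, hv, hv'⟩ := (LinearPMap.mem_graph_iff _).1 h2
    dsimp only at hv hv'
    refine ⟨hv ▸ v.2, ?_⟩
    rw [← hv']
    congr 1
    exact Subtype.ext hv.symm

/-- The unitary operator `refl ∘ flipSign` with `(1 + A)⁻¹ = (1 + refl ∘ flipSign) / 2`. -/
def cayley : StateSpace H₀ H₁ Y ≃ₗᵢ[ℂ] StateSpace H₀ H₁ Y :=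
  (flipSign H₀ H₁ Y).trans 𝒞.graphSubspace.reflection

/-- The resolvent `(1 + A)⁻¹`. -/
def resolvent : StateSpace H₀ H₁ Y →L[ℂ] StateSpace H₀ H₁ Y :=
  (1 / 2 : ℂ) • (1 + (𝒞.cayley : StateSpace H₀ H₁ Y →L[ℂ] StateSpace H₀ H₁ Y))

theorem resolvent_apply (x : StateSpace H₀ H₁ Y) :
    𝒞.resolvent x = (1 / 2 : ℂ) • (x + 𝒞.cayley x) := rfl

theorem re_inner_A (p : 𝒞.A.domain) : (inner ℂ (p : StateSpace H₀ H₁ Y) (𝒞.A p)).re = 0 := by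
  have h := (LinearPMap.adjoint_isFormalAdjoint 𝒞.F_dense) ⟨_, p.2.2⟩ ⟨_, p.2.1⟩
  have h1 : inner ℂ (p : StateSpace H₀ H₁ Y) (𝒞.A p) =
      inner ℂ p.1.fst.fst (𝒞.F.adjoint ⟨p.1.fst.snd, p.2.2⟩) +
        inner ℂ p.1.fst.snd (-𝒞.F ⟨p.1.fst.fst, p.2.1⟩) + inner ℂ p.1.snd (0 : Y) := rfl
  rw [h1, inner_neg_right, ← h, inner_zero_right, add_zero, ← inner_conj_symm,
    Complex.add_re, Complex.neg_re, Complex.conj_re]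
  exact add_neg_cancel _

/-- Solving (1 + A)w = x is an orthogonal decomposition. Split the sign-flipped x into a = (u, F u,
y) in G(F) ⊕ Y and b = (F*q, -q, 0) in its complement. Then w = (u, q, y) is the solution: (1 + A)w
= (u + F*q, q - F u, y), which is a + b with its middle entry flipped back. -/
theorem resolvent_spec (x : StateSpace H₀ H₁ Y) :
    ∃ h : 𝒞.resolvent x ∈ 𝒞.A.domain, 𝒞.resolvent x + 𝒞.A ⟨𝒞.resolvent x, h⟩ = x := by
  set a := 𝒞.graphSubspace.starProjection (flipSign H₀ H₁ Y x) with ha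
  set b := flipSign H₀ H₁ Y x - a with hb
  have ha' : a ∈ 𝒞.graphSubspace := Submodule.starProjection_apply_mem _ _
  have hb' : b ∈ 𝒞.graphSubspaceᗮ := Submodule.sub_starProjection_mem_orthogonal _
  obtain ⟨hb0, hb1, hb2⟩ := 𝒞.mem_graphSubspace_orthogonal hb'
  obtain ⟨u, hu, hu'⟩ := (LinearPMap.mem_graph_iff _).1 (𝒞.mem_graphSubspace.1 ha')
  dsimp only at hu hu'
  have hc : 𝒞.cayley x = a - b := by
    change 𝒞.graphSubspace.reflection (flipSign H₀ H₁ Y x) = _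
    rw [Submodule.reflection_apply, hb, ← ha, two_smul]
    abel
  have hx : x = flipSign H₀ H₁ Y (a + b) := by
    rw [hb, add_sub_cancel]
    exact ((flipSign H₀ H₁ Y).symm_apply_apply x).symm
  have hres : 𝒞.resolvent x = WithLp.toLp 2 (WithLp.toLp 2 (a.fst.fst, -b.fst.snd), a.snd) := by
    rw [resolvent_apply, hc]
    conv_lhs => rw [hx]
    refine WithLp.ofLp_injective 2 (Prod.ext (WithLp.ofLp_injective 2 (Prod.ext ?_ ?_)) ?_)
    · change (1 / 2 : ℂ) • ((a.fst.fst + b.fst.fst) + (a.fst.fst - b.fst.fst)) = a.fst.fst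
      module
    · change (1 / 2 : ℂ) • (-(a.fst.snd + b.fst.snd) + (a.fst.snd - b.fst.snd)) = -b.fst.snd
      module
    · change (1 / 2 : ℂ) • ((a.snd + b.snd) + (a.snd - b.snd)) = a.snd
      module
  have hmem : 𝒞.resolvent x ∈ 𝒞.A.domain := by
    rw [hres]
    exact ⟨(hu ▸ u.2 : a.fst.fst ∈ 𝒞.F.domain), hb1⟩
  refine ⟨hmem, ?_⟩
  have hA : 𝒞.A ⟨𝒞.resolvent x, hmem⟩ =
      WithLp.toLp 2 (WithLp.toLp 2 (b.fst.fst, -a.fst.snd), 0) := by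
    have hF : 𝒞.F u = 𝒞.F ⟨a.fst.fst, hu ▸ u.2⟩ := congrArg _ (Subtype.ext hu)
    have h1 : (⟨𝒞.resolvent x, hmem⟩ : 𝒞.A.domain) =
        ⟨WithLp.toLp 2 (WithLp.toLp 2 (a.fst.fst, -b.fst.snd), a.snd), hres ▸ hmem⟩ :=
      Subtype.ext hres
    rw [h1, ← hb2, ← hu', hF]
    rfl
  rw [hA, hres]
  conv_rhs => rw [hx]
  refine WithLp.ofLp_injective 2 (Prod.ext (WithLp.ofLp_injective 2 (Prod.ext ?_ ?_)) ?_)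
  · rfl
  · change -b.fst.snd + -a.fst.snd = -(a.fst.snd + b.fst.snd)
    abel
  · change a.snd + 0 = a.snd + b.snd
    rw [hb0]

theorem isSkewResolvent : IsSkewResolvent 𝒞.A 𝒞.resolvent := by
  have hre : ∀ x, (inner ℂ (𝒞.resolvent x) x).re = ‖𝒞.resolvent x‖ ^ 2 := by
    intro x
    obtain ⟨h, hx⟩ := 𝒞.resolvent_spec x
    have h0 := 𝒞.re_inner_A ⟨_, h⟩
    rw [← congrArg (inner ℂ (𝒞.resolvent x)) hx, inner_add_right, Complex.add_re, h0]
    simp [inner_self_eq_norm_sq_to_K, ← Complex.ofReal_pow]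
  refine ⟨fun x => (𝒞.resolvent_spec x).1, fun x h => (𝒞.resolvent_spec x).2, fun p => ?_, hre, ?_⟩
  · obtain ⟨h, hx⟩ := 𝒞.resolvent_spec (p + 𝒞.A p)
    set q : 𝒞.A.domain := ⟨𝒞.resolvent (p + 𝒞.A p), h⟩
    -- Injectivity of 1 + A: a difference d of two solutions has A d = -d, while Re ⟨d, A d⟩ = 0.
    have h1 : ((q - p : 𝒞.A.domain) : StateSpace H₀ H₁ Y) + 𝒞.A (q - p) = 0 := by
      rw [LinearPMap.map_sub, AddSubgroupClass.coe_sub, sub_add_sub_comm, sub_eq_zero]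
      exact hx
    have h2 := 𝒞.re_inner_A (q - p)
    rw [eq_neg_of_add_eq_zero_right h1, inner_neg_right, Complex.neg_re, neg_eq_zero] at h2
    have h3 : ((q - p : 𝒞.A.domain) : StateSpace H₀ H₁ Y) = 0 := by
      have h4 := inner_self_eq_norm_sq (𝕜 := ℂ) ((q - p : 𝒞.A.domain) : StateSpace H₀ H₁ Y)
      exact norm_eq_zero.1 (pow_eq_zero_iff two_ne_zero |>.1 (h4.symm.trans h2))
    exact sub_eq_zero.1 h3
  · intro x
    -- For the unitary C = `cayley`, R* = (1 + C⁻¹)/2. Since C maps x + C⁻¹x to C x + x, the norms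
    -- of R* x and R x agree.
    have h1 : 𝒞.resolvent.adjoint x = (1 / 2 : ℂ) • (x + 𝒞.cayley.symm x) := by
      refine ext_inner_left ℂ fun y => ?_
      rw [ContinuousLinearMap.adjoint_inner_right, resolvent_apply, inner_smul_left, inner_smul_right,
        inner_add_left, inner_add_right, 𝒞.cayley.inner_map_eq_flip]
      congr 1
      simp only [map_div₀, map_one, map_ofNat]
    rw [h1, resolvent_apply, norm_smul, norm_smul, ← 𝒞.cayley.norm_map (x + _), map_add,
      LinearIsometryEquiv.apply_symm_apply, add_comm]

end AbstractLinearControlSystem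

/-! ### The extension of A and the symbol of ∂₀ -/

section Operators

variable {H : Type*} [NormedAddCommGroup H] [InnerProductSpace ℂ H] [CompleteSpace H] {ν : ℝ}

/-- The extension of a skew-selfadjoint `A` to `H_{ν,0}(ℝ; H)` in terms of its resolvent. -/
theorem IsSkewResolvent.mem_extension_iff {A : H →ₗ.[ℂ] H} {R : H →L[ℂ] H}
    (hR : IsSkewResolvent A R) {u w : HSpace ν H} :
    (u, w) ∈ extension ν A ↔ constOp ν R (u + w) = u := by
  constructor
  · intro h
    have hcl : IsClosed {p : HSpace ν H × HSpace ν H | constOp ν R (p.1 + p.2) = p.1} :=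
      isClosed_eq (by fun_prop) (by fun_prop)
    have hsub : (simpleGraph ν A : Set (HSpace ν H × HSpace ν H)) ⊆
        {p | constOp ν R (p.1 + p.2) = p.1} := by
      rintro ⟨u, w⟩ ⟨s, h1, h2⟩
      refine Lp.ext ((R.coeFn_compLpL _).trans ?_)
      filter_upwards [h1, h2, Lp.coeFn_add u w] with t h1 h2 h3
      rw [h3, Pi.add_apply, h1, h2]
      exact hR.left_inv (s t)
    exact closure_minimal hsub hcl h
  · intro h
    -- The graph is parametrised by g = u + w through (R g, g - R g). Simple functions g give
    -- elements of the simple graph, and they are dense.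
    obtain ⟨g, rfl, rfl⟩ : ∃ g, u = constOp ν R g ∧ w = g - constOp ν R g :=
      ⟨u + w, h.symm, by rw [h]; abel⟩
    clear h
    have hcont : Continuous fun g : HSpace ν H => (constOp ν R g, g - constOp ν R g) := by
      fun_prop
    have hd := Lp.simpleFunc.dense (E := H) (p := 2) (μ := expMeasure ν) (by norm_num)
    refine map_mem_closure (f := fun g => (constOp ν R g, g - constOp ν R g)) hcont (hd g) fun g hg => ?_
    set s := Lp.simpleFunc.toSimpleFunc (⟨g, hg⟩ : Lp.simpleFunc H 2 (expMeasure ν))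
    have hs : s =ᵐ[expMeasure ν] g := Lp.simpleFunc.toSimpleFunc_eq_toFun _
    refine ⟨s.map fun x => ⟨R x, hR.mem_domain x⟩, ?_, ?_⟩
    · filter_upwards [R.coeFn_compLpL g, hs] with t h1 h2
      rw [h1, ← h2]
      rfl
    · filter_upwards [R.coeFn_compLpL g, hs, Lp.coeFn_sub g (constOp ν R g)] with t h1 h2 h3
      rw [h3, Pi.sub_apply, h1, ← h2, SimpleFunc.map_apply, sub_eq_iff_eq_add']
      exact (hR.apply_add _ _).symm

/-- The material law `z ↦ z`, which yields the operator `∂₀⁻¹`. -/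
def idLaw (H : Type*) [NormedAddCommGroup H] [InnerProductSpace ℂ H] (r : ℝ) :
    MaterialLaw H r where
  toFun z := z • ContinuousLinearMap.id ℂ H
  analytic := analyticOnNhd_id.smul analyticOnNhd_const
  bounded := by
    refine ⟨(|r| + r) * ‖ContinuousLinearMap.id ℂ H‖, fun z hz => ?_⟩
    rw [norm_smul]
    gcongr
    rw [Metric.mem_ball, dist_eq_norm] at hz
    have h := norm_add_le (z - (r : ℂ)) (r : ℂ)
    rw [sub_add_cancel, Complex.norm_real, Real.norm_eq_abs] at h
    linarith

theorem mul_spectralPoint (hν : 0 < ν) (x : ℝ) :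
    (Complex.I * (2 * Real.pi * x : ℝ) + ν) * spectralPoint ν x = 1 := by
  refine mul_inv_cancel₀ fun h => ?_
  have := congrArg Complex.re h
  simp at this
  linarith

/-- The function e^{-νt}φ is again a test function, and e^{-νt}φ' = (e^{-νt}φ)' + νe^{-νt}φ; the
Fourier transform turns the derivative into 2πix. -/
theorem fourierLaplace_testDeriv {p q : HSpace ν H} (h : (p, q) ∈ testDerivGraph ν H) :
    fourierLaplace ν H q =ᵐ[volume]
      fun x => (Complex.I * (2 * Real.pi * x : ℝ) + ν) • fourierLaplace ν H p x := by
  obtain ⟨φ, hφ, hc, hp, hq⟩ := h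
  have hsm : ContDiff ℝ (⊤ : ℕ∞) fun t => (Real.exp (-ν * t) : ℂ) • φ t := by
    refine ContDiff.smul ?_ hφ
    exact Complex.ofRealCLM.contDiff.comp (Real.contDiff_exp.comp (by fun_prop))
  have hcs : HasCompactSupport fun t => (Real.exp (-ν * t) : ℂ) • φ t := hc.smul_left
  set ψ : SchwartzMap ℝ H := hcs.toSchwartzMap hsm with hψ
  have hψt : ∀ t, ψ t = (Real.exp (-ν * t) : ℂ) • φ t := fun t => rfl
  have hderiv : ∀ t, deriv ψ t = (Real.exp (-ν * t) : ℂ) • deriv φ t - (ν : ℂ) • ψ t := by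
    intro t
    have h1 : HasDerivAt (fun t : ℝ => (Real.exp (-ν * t) : ℂ)) (-ν * Real.exp (-ν * t) : ℂ) t := by
      have := (((hasDerivAt_id t).const_mul (-ν)).exp).ofReal_comp
      simpa [mul_comm] using this
    have h2 : HasDerivAt φ (deriv φ t) t := (hφ.differentiable (by simp) t).hasDerivAt
    have h3 := (h1.smul h2).deriv
    change deriv (fun t => (Real.exp (-ν * t) : ℂ) • φ t) t = _
    rw [hψt]
    refine Eq.trans h3 ?_
    module
  have hp' : expMul ν H p = ψ.toLp 2 volume := by
    apply Lp.ext
    filter_upwards [expMul_ae p, ψ.coeFn_toLp 2 volume, (ac_expMeasure ν).ae_le hp] with t h1 h2 h3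
    rw [h1, h2, hψt, h3]
  have hq' : expMul ν H q = (SchwartzMap.derivCLM ℂ H ψ).toLp 2 volume + (ν : ℂ) • ψ.toLp 2 volume := by
    apply Lp.ext
    filter_upwards [expMul_ae q, ψ.coeFn_toLp 2 volume, (ac_expMeasure ν).ae_le hq,
      (SchwartzMap.derivCLM ℂ H ψ).coeFn_toLp 2 volume,
      Lp.coeFn_add ((SchwartzMap.derivCLM ℂ H ψ).toLp 2 volume) ((ν : ℂ) • ψ.toLp 2 volume),
      Lp.coeFn_smul (ν : ℂ) (ψ.toLp 2 volume)] with t h1 h2 h3 h4 h5 h6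
    rw [h1, h5, Pi.add_apply, h6, Pi.smul_apply, h4, h2, h3, SchwartzMap.derivCLM_apply, hderiv]
    abel
  have hFp : fourierLaplace ν H p = (FourierTransform.fourier ψ).toLp 2 volume := by
    rw [← SchwartzMap.toLp_fourier_eq, ← hp']
    rfl
  have hFq : fourierLaplace ν H q =
      (FourierTransform.fourier (SchwartzMap.derivCLM ℂ H ψ)).toLp 2 volume +
        (ν : ℂ) • (FourierTransform.fourier ψ).toLp 2 volume := by
    rw [← SchwartzMap.toLp_fourier_eq, ← SchwartzMap.toLp_fourier_eq]
    change Lp.fourierTransformₗᵢ ℝ H (expMul ν H q) = _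
    rw [hq', map_add, map_smul]
    rfl
  rw [hFp, hFq]
  filter_upwards [Lp.coeFn_add ((FourierTransform.fourier (SchwartzMap.derivCLM ℂ H ψ)).toLp 2 volume)
      ((ν : ℂ) • (FourierTransform.fourier ψ).toLp 2 volume),
    Lp.coeFn_smul (ν : ℂ) ((FourierTransform.fourier ψ).toLp 2 volume),
    (FourierTransform.fourier ψ).coeFn_toLp 2 volume,
    (FourierTransform.fourier (SchwartzMap.derivCLM ℂ H ψ)).coeFn_toLp 2 volume] with x h1 h2 h3 h4
  rw [h1, Pi.add_apply, h2, Pi.smul_apply, h3, h4, SchwartzMap.fourier_coe, SchwartzMap.fourier_coe,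
    add_smul]
  have h5 : (SchwartzMap.derivCLM ℂ H ψ : ℝ → H) = deriv ψ :=
    funext fun t => SchwartzMap.derivCLM_apply ..
  rw [h5, Real.fourier_deriv ψ.integrable ψ.differentiable
    (h5 ▸ (SchwartzMap.derivCLM ℂ H ψ).integrable)]
  congr 2
  push_cast
  ring_nf

theorem idLaw_op_testDeriv {r : ℝ} (hr : 0 < r) (hν : 1 / (2 * r) < ν) {p q : HSpace ν H}
    (h : (p, q) ∈ testDerivGraph ν H) : (idLaw H r).op hr hν q = p := by
  apply (fourierLaplace ν H).injective
  apply Lp.ext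
  filter_upwards [(idLaw H r).hasSymbol_op hr hν q, fourierLaplace_testDeriv h] with x h1 h2
  rw [h1, h2]
  change spectralPoint ν x • ((Complex.I * (2 * Real.pi * x : ℝ) + ν) • fourierLaplace ν H p x) = _
  rw [smul_smul, mul_comm, mul_spectralPoint (lt_trans (by positivity) hν), one_smul]

end Operators

/-! ### Density of derivatives of test functions -/

section Density

instance (ν : ℝ) : IsLocallyFiniteMeasure (expMeasure ν) :=
  IsLocallyFiniteMeasure.withDensity_ofReal (by fun_prop)

theorem expMeasure_Icc_le {ν : ℝ} (hν : 0 ≤ ν) (n : ℝ) :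
    expMeasure ν (Set.Icc n (n + 1)) ≤ ENNReal.ofReal (Real.exp (-2 * ν * n)) := by
  rw [expMeasure, withDensity_apply _ measurableSet_Icc]
  calc ∫⁻ t in Set.Icc n (n + 1), ENNReal.ofReal (Real.exp (-2 * ν * t))
      ≤ ∫⁻ _ in Set.Icc n (n + 1), ENNReal.ofReal (Real.exp (-2 * ν * n)) := by
        refine setLIntegral_mono measurable_const fun t ht => ?_
        refine ENNReal.ofReal_le_ofReal (Real.exp_le_exp.2 ?_)
        nlinarith [ht.1]
    _ = _ := by simp

theorem deriv_smoothTransition_eq_zero {t : ℝ} (ht : t < 0 ∨ 1 < t) :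
    deriv Real.smoothTransition t = 0 := by
  rcases ht with ht | ht
  · have : Real.smoothTransition =ᶠ[nhds t] fun _ => 0 := by
      filter_upwards [Iio_mem_nhds ht] with s hs
      exact Real.smoothTransition.zero_of_nonpos (le_of_lt hs)
    rw [this.deriv_eq, deriv_const]
  · have : Real.smoothTransition =ᶠ[nhds t] fun _ => 1 := by
      filter_upwards [Ioi_mem_nhds ht] with s hs
      exact Real.smoothTransition.one_of_one_le (le_of_lt hs)
    rw [this.deriv_eq, deriv_const]

theorem exists_bound_deriv_smoothTransition : ∃ K : ℝ, ∀ t, |deriv Real.smoothTransition t| ≤ K := by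
  have hcont : Continuous (deriv Real.smoothTransition) :=
    (Real.smoothTransition.contDiff (n := 1)).continuous_deriv le_rfl
  have hc : HasCompactSupport (deriv Real.smoothTransition) := by
    refine HasCompactSupport.intro (isCompact_Icc (a := (0 : ℝ)) (b := 1)) fun t ht => ?_
    rw [Set.mem_Icc, not_and_or, not_le, not_le] at ht
    exact deriv_smoothTransition_eq_zero ht
  obtain ⟨K, hK⟩ := hcont.bounded_above_of_compact_support hc
  exact ⟨K, fun t => hK t⟩

variable {H : Type*} [NormedAddCommGroup H] [InnerProductSpace ℂ H] [CompleteSpace H] {ν : ℝ}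

/-- A test function `ψ` is approximated in `H_{ν,0}(ℝ; H)` by derivatives of test functions, namely
of smoothly truncated primitives of `ψ`. -/
theorem exists_deriv_near (hν : 0 < ν) {ψ : ℝ → H} (hc : HasCompactSupport ψ)
    (hψ : ContDiff ℝ (⊤ : ℕ∞) ψ) {ε : ℝ≥0∞} (hε : 0 < ε) :
    ∃ φ : ℝ → H, ContDiff ℝ (⊤ : ℕ∞) φ ∧ HasCompactSupport φ ∧
      eLpNorm (deriv φ - ψ) 2 (expMeasure ν) ≤ ε := by
  obtain ⟨b, hb⟩ : ∃ b : ℝ, ∀ t, b ≤ |t| → ψ t = 0 := by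
    obtain ⟨b, hb⟩ := hc.isCompact.isBounded.subset_ball 0
    refine ⟨b, fun t ht => image_eq_zero_of_notMem_tsupport fun h => ?_⟩
    have := hb h
    rw [mem_ball_zero_iff, Real.norm_eq_abs] at this
    linarith
  have hψl : ∀ t ≤ -|b|, ψ t = 0 := fun t ht => hb t (by
    have := le_abs_self b; have := neg_le_abs t; linarith)
  have hψr : ∀ t, |b| ≤ t → ψ t = 0 := fun t ht => hb t (by
    have := le_abs_self b; have := le_abs_self t; linarith)
  -- This primitive vanishes left of -|b| and is constant right of |b|. Only the right tail must be
  -- cut off, where for ν > 0 the weight is small.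
  set Ψ : ℝ → H := fun t => ∫ s in (-|b|)..t, ψ s with hΨ
  have hint : ∀ x y, IntervalIntegrable ψ volume x y := fun x y =>
    hψ.continuous.intervalIntegrable x y
  have hΨd : ∀ t, HasDerivAt Ψ (ψ t) t := fun t =>
    intervalIntegral.integral_hasDerivAt_right (hint _ _)
      (hψ.continuous.stronglyMeasurableAtFilter _ _) hψ.continuous.continuousAt
  have hΨs : ContDiff ℝ (⊤ : ℕ∞) Ψ := by
    rw [contDiff_infty_iff_deriv]
    refine ⟨fun t => (hΨd t).differentiableAt, ?_⟩
    rwa [show deriv Ψ = ψ from funext fun t => (hΨd t).deriv]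
  have hΨl : ∀ t ≤ -|b|, Ψ t = 0 := by
    intro t ht
    refine intervalIntegral.integral_zero_ae (Filter.Eventually.of_forall fun s hs => hψl s ?_)
    rw [Set.uIoc_of_ge ht] at hs
    exact hs.2
  have hΨr : ∀ t, |b| ≤ t → Ψ t = Ψ |b| := by
    intro t ht
    rw [← sub_eq_zero, hΨ, intervalIntegral.integral_interval_sub_left (hint _ _) (hint _ _)]
    refine intervalIntegral.integral_zero_ae (Filter.Eventually.of_forall fun s hs => hψr s ?_)
    rw [Set.uIoc_of_le ht] at hs
    exact hs.1.le
  obtain ⟨K, hK⟩ := exists_bound_deriv_smoothTransition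
  have hK0 : 0 ≤ K := (abs_nonneg _).trans (hK 0)
  have htend : Filter.Tendsto (fun n : ℝ => ENNReal.ofReal (K * ‖Ψ |b|‖) *
      ENNReal.ofReal (Real.exp (-2 * ν * n)) ^ (1 / 2 : ℝ)) Filter.atTop (nhds 0) := by
    have h1 : Filter.Tendsto (fun n : ℝ => Real.exp (-2 * ν * n)) Filter.atTop (nhds 0) :=
      Real.tendsto_exp_atBot.comp (Filter.tendsto_id.const_mul_atTop_of_neg (by linarith))
    have h2 := (ENNReal.continuous_rpow_const (y := 1 / 2)).tendsto _ |>.comp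
      (ENNReal.tendsto_ofReal h1)
    have h3 := ENNReal.Tendsto.const_mul (a := ENNReal.ofReal (K * ‖Ψ |b|‖)) h2
      (Or.inr ENNReal.ofReal_ne_top)
    simpa [Function.comp_def] using h3
  -- The cutoff equals 1 up to n and 0 from n + 1 on. Since n ≥ |b|, the error is the cutoff's
  -- derivative times the constant Ψ |b|, supported in [n, n + 1]; its weighted norm is at most K‖Ψ
  -- |b|‖e^{-νn}.
  obtain ⟨n, hn, hbn⟩ := ((htend.eventually_le_const hε).and (Filter.eventually_ge_atTop |b|)).exists
  have hχd : ∀ t, HasDerivAt (fun t => Real.smoothTransition (n + 1 - t))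
      (-deriv Real.smoothTransition (n + 1 - t)) t := by
    intro t
    have h1 : HasDerivAt Real.smoothTransition _ (n + 1 - t) :=
      ((Real.smoothTransition.contDiff (n := 1)).differentiable one_ne_zero _).hasDerivAt
    simpa using h1.comp_const_sub (n + 1) t
  refine ⟨fun t => Real.smoothTransition (n + 1 - t) • Ψ t, ?_, ?_, ?_⟩
  · exact (Real.smoothTransition.contDiff.comp (by fun_prop)).smul hΨs
  · refine HasCompactSupport.intro (isCompact_Icc (a := -|b|) (b := n + 1)) fun t ht => ?_
    rw [Set.mem_Icc, not_and_or, not_le, not_le] at ht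
    rcases ht with ht | ht
    · rw [hΨl t ht.le, smul_zero]
    · rw [Real.smoothTransition.zero_of_nonpos (by linarith), zero_smul]
  · have hdiff : ∀ t, ‖(deriv (fun t => Real.smoothTransition (n + 1 - t) • Ψ t) - ψ) t‖ ≤
        ‖(Set.Icc n (n + 1)).indicator (fun _ => K * ‖Ψ |b|‖) t‖ := by
      intro t
      rw [Pi.sub_apply, ((hχd t).fun_smul (hΨd t)).deriv]
      rcases lt_or_ge t n with ht | ht
      · have h1 : deriv Real.smoothTransition (n + 1 - t) = 0 :=
          deriv_smoothTransition_eq_zero (Or.inr (by linarith))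
        rw [h1, Real.smoothTransition.one_of_one_le (by linarith)]
        simp
      · rw [hψr t (hbn.trans ht), hΨr t (hbn.trans ht), smul_zero, zero_add, sub_zero, norm_smul,
          norm_neg, Real.norm_eq_abs]
        rcases le_or_gt t (n + 1) with ht' | ht'
        · rw [Set.indicator_of_mem (Set.mem_Icc.2 ⟨ht, ht'⟩), Real.norm_of_nonneg (by positivity)]
          exact mul_le_mul_of_nonneg_right (hK _) (norm_nonneg _)
        · have h1 : deriv Real.smoothTransition (n + 1 - t) = 0 :=
            deriv_smoothTransition_eq_zero (Or.inl (by linarith))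
          rw [h1, abs_zero, zero_mul]
          exact norm_nonneg _
    refine (eLpNorm_mono hdiff).trans ?_
    rw [eLpNorm_indicator_const measurableSet_Icc (by norm_num) (by norm_num)]
    refine le_trans ?_ hn
    rw [← ofReal_norm, Real.norm_of_nonneg (by positivity)]
    rw [ENNReal.toReal_ofNat]
    gcongr
    exact expMeasure_Icc_le hν.le n

theorem dense_range_testDeriv (hν : 0 < ν) :
    Dense {q : HSpace ν H | ∃ p, (p, q) ∈ testDerivGraph ν H} := by
  have hd := MeasureTheory.Lp.dense_hasCompactSupport_contDiff (p := 2) (μ := expMeasure ν) (F := H)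
    (E := ℝ) (by norm_num)
  refine fun g => closure_minimal ?_ isClosed_closure (hd g)
  rintro g ⟨ψ, hg, hc, hψ⟩
  refine EMetric.mem_closure_iff.2 fun ε hε => ?_
  obtain ⟨δ, hδ, hδε⟩ := exists_between hε
  obtain ⟨φ, hφ, hφc, hle⟩ := exists_deriv_near hν hc hψ hδ
  have h1 : MemLp φ 2 (expMeasure ν) := hφ.continuous.memLp_of_hasCompactSupport hφc
  have h2 : MemLp (deriv φ) 2 (expMeasure ν) :=
    (hφ.continuous_deriv (by simp)).memLp_of_hasCompactSupport hφc.deriv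
  refine ⟨h2.toLp, ⟨h1.toLp, φ, hφ, hφc, h1.coeFn_toLp, h2.coeFn_toLp⟩, ?_⟩
  rw [edist_comm, Lp.edist_def, eLpNorm_congr_ae (h2.coeFn_toLp.sub hg)]
  exact hle.trans_lt hδε

/-- One inclusion holds because the bounded operator ∂₀⁻¹ inverts the derivative on test functions
and this relation is closed. The other needs that derivatives of test functions are dense, so that
the closure reaches every q. -/
theorem mem_timeDeriv_iff {r : ℝ} (hr : 0 < r) (hν : 1 / (2 * r) < ν) {p q : HSpace ν H} :
    (p, q) ∈ timeDeriv ν H ↔ (idLaw H r).op hr hν q = p := by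
  constructor
  · intro h
    have hsub : ∀ p q, (p, q) ∈ testDerivGraph ν H → (idLaw H r).op hr hν q = p :=
      fun p q => idLaw_op_testDeriv hr hν
    generalize (idLaw H r).op hr hν = D at hsub ⊢
    have hcl : IsClosed {x : HSpace ν H × HSpace ν H | D x.2 = x.1} :=
      isClosed_eq (by fun_prop) (by fun_prop)
    exact closure_minimal (fun x hx => hsub x.1 x.2 hx) hcl h
  · rintro rfl
    have hcont : Continuous fun q : HSpace ν H => ((idLaw H r).op hr hν q, q) := by fun_prop
    refine map_mem_closure (f := fun q => ((idLaw H r).op hr hν q, q)) hcont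
      (dense_range_testDeriv (lt_trans (by positivity) hν) q) ?_
    rintro q ⟨p, hp⟩
    change ((idLaw H r).op hr hν q, q) ∈ testDerivGraph ν H
    rwa [idLaw_op_testDeriv hr hν hp]

/-- The range of `∂₀⁻¹` is dense. -/
theorem denseRange_idLaw_op {r : ℝ} (hr : 0 < r) (hν : 1 / (2 * r) < ν) :
    DenseRange ((idLaw H r).op hr hν : HSpace ν H → HSpace ν H) := by
  refine (MeasureTheory.Lp.dense_hasCompactSupport_contDiff (p := 2) (μ := expMeasure ν) (F := H)
    (E := ℝ) (by norm_num)).mono ?_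
  rintro g ⟨φ, hg, hφc, hφ⟩
  have h2 : MemLp (deriv φ) 2 (expMeasure ν) :=
    (hφ.continuous_deriv (by simp)).memLp_of_hasCompactSupport hφc.deriv
  exact ⟨h2.toLp, idLaw_op_testDeriv hr hν ⟨φ, hφ, hφc, hg, h2.coeFn_toLp⟩⟩

end Density

/-! ### Truncations and causality of ∂₀⁻¹ -/

section Causality

variable {H : Type*} [NormedAddCommGroup H] {ν : ℝ}

theorem truncate_ae (a : ℝ) (f : HSpace ν H) :
    truncate a f =ᵐ[expMeasure ν] (Set.Iic a).indicator f :=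
  MemLp.coeFn_toLp _

theorem truncate_eq_zero_iff {a : ℝ} {f : HSpace ν H} :
    truncate a f = 0 ↔ ∀ᵐ t ∂expMeasure ν, t ≤ a → f t = 0 := by
  rw [Lp.eq_zero_iff_ae_eq_zero]
  constructor
  · intro h
    filter_upwards [h, truncate_ae a f] with t h1 h2 ht
    rwa [h2, Set.indicator_of_mem (Set.mem_Iic.2 ht)] at h1
  · intro h
    filter_upwards [h, truncate_ae a f] with t h1 h2
    rw [h2]
    by_cases ht : t ≤ a
    · rw [Set.indicator_of_mem (Set.mem_Iic.2 ht), h1 ht]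
      rfl
    · rw [Set.indicator_of_notMem (by simpa using ht)]
      rfl

theorem truncate_sub (a : ℝ) (f g : HSpace ν H) :
    truncate a (f - g) = truncate a f - truncate a g := by
  apply Lp.ext
  filter_upwards [truncate_ae a (f - g), truncate_ae a f, truncate_ae a g, Lp.coeFn_sub f g,
    Lp.coeFn_sub (truncate a f) (truncate a g)] with t h1 h2 h3 h4 h5
  rw [h1, h5, Pi.sub_apply, h2, h3]
  by_cases ht : t ∈ Set.Iic a
  · rw [Set.indicator_of_mem ht, Set.indicator_of_mem ht, Set.indicator_of_mem ht, h4]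
    rfl
  · rw [Set.indicator_of_notMem ht, Set.indicator_of_notMem ht, Set.indicator_of_notMem ht, sub_zero]

theorem norm_truncate_le (a : ℝ) (f : HSpace ν H) : ‖truncate a f‖ ≤ ‖f‖ := by
  refine Lp.norm_le_norm_of_ae_le ?_
  filter_upwards [truncate_ae a f] with t h1
  rw [h1]
  exact norm_indicator_le_norm_self _ _

theorem continuous_truncate (a : ℝ) : Continuous (truncate (ν := ν) (H := H) a) := by
  refine (LipschitzWith.of_dist_le_mul (K := 1) fun f g => ?_).continuous
  rw [dist_eq_norm, dist_eq_norm, ← truncate_sub, NNReal.coe_one, one_mul]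
  exact norm_truncate_le a _

theorem truncate_truncate (a : ℝ) (f : HSpace ν H) : truncate a (truncate a f) = truncate a f := by
  rw [← sub_eq_zero, ← truncate_sub, truncate_eq_zero_iff]
  filter_upwards [truncate_ae a f, Lp.coeFn_sub (truncate a f) f] with t h1 h2 ht
  rw [h2, Pi.sub_apply, h1, Set.indicator_of_mem (Set.mem_Iic.2 ht), sub_self]

variable [InnerProductSpace ℂ H]

/-- A linear operator is causal iff it maps functions vanishing on `(-∞, a]` to such functions. -/
theorem isCausal_iff {T : HSpace ν H →L[ℂ] HSpace ν H} :
    IsCausal T ↔ ∀ (a : ℝ) (f : HSpace ν H), truncate a f = 0 → truncate a (T f) = 0 := by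
  have h0 : ∀ a, truncate a (0 : HSpace ν H) = 0 := fun a => by
    rw [← sub_self (0 : HSpace ν H), truncate_sub, sub_self, sub_self]
  constructor
  · intro h a f hf
    rw [← h a f, hf, map_zero, h0]
  · intro h a f
    rw [← sub_eq_zero, ← truncate_sub, ← map_sub]
    exact h a _ (by rw [truncate_sub, truncate_truncate, sub_self])

namespace IsCausal

variable {S T : HSpace ν H →L[ℂ] HSpace ν H}

theorem zero : IsCausal (0 : HSpace ν H →L[ℂ] HSpace ν H) :=
  fun _ _ => rfl

theorem add (hS : IsCausal S) (hT : IsCausal T) : IsCausal (S + T) := by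
  rw [isCausal_iff] at *
  intro a f hf
  have h1 := truncate_eq_zero_iff.1 (hS a f hf)
  have h2 := truncate_eq_zero_iff.1 (hT a f hf)
  rw [truncate_eq_zero_iff]
  filter_upwards [h1, h2, Lp.coeFn_add (S f) (T f)] with t h1 h2 h3 ht
  rw [add_apply, h3, Pi.add_apply, h1 ht, h2 ht, add_zero]

theorem comp (hS : IsCausal S) (hT : IsCausal T) : IsCausal (S ∘L T) := by
  rw [isCausal_iff] at *
  exact fun a f hf => hS a _ (hT a f hf)

theorem of_tendsto {T' : ℕ → HSpace ν H →L[ℂ] HSpace ν H} (h : ∀ n, IsCausal (T' n))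
    (hT : ∀ f, Filter.Tendsto (fun n => T' n f) Filter.atTop (nhds (T f))) : IsCausal T := by
  rw [isCausal_iff]
  intro a f hf
  refine tendsto_nhds_unique (((continuous_truncate a).tendsto _).comp (hT f)) ?_
  refine tendsto_const_nhds.congr fun n => ?_
  exact (isCausal_iff.1 (h n) a f hf).symm

theorem constOp (L : H →L[ℂ] H) : IsCausal (constOp ν L) := by
  rw [isCausal_iff]
  intro a f hf
  rw [truncate_eq_zero_iff] at *
  filter_upwards [hf, L.coeFn_compLpL f] with t h1 h2 ht
  rw [h2, h1 ht, map_zero]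

end IsCausal

theorem norm_truncate_sq {a : ℝ} {f : HSpace ν H} {φ : ℝ → H} (hf : f =ᵐ[expMeasure ν] φ) :
    ‖truncate a f‖ ^ 2 = ∫ t in Set.Iic a, Real.exp (-2 * ν * t) * ‖φ t‖ ^ 2 := by
  have h1 : ‖truncate a f‖ ^ 2 = ∫ t, ‖truncate a f t‖ ^ 2 ∂expMeasure ν := by
    have h2 : ((‖truncate a f‖ ^ 2 : ℝ) : ℂ) = ((∫ t, ‖truncate a f t‖ ^ 2 ∂expMeasure ν : ℝ) : ℂ) := by
      have h3 := inner_self_eq_norm_sq_to_K (𝕜 := ℂ) (truncate a f)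
      rw [L2.inner_def] at h3
      simp only [inner_self_eq_norm_sq_to_K] at h3
      rw [← integral_complex_ofReal]
      push_cast
      exact h3.symm
    exact_mod_cast h2
  have h4 : ∫ t, ‖truncate a f t‖ ^ 2 ∂expMeasure ν =
      ∫ t, (Set.Iic a).indicator (fun t => ‖φ t‖ ^ 2) t ∂expMeasure ν := by
    refine integral_congr_ae ?_
    filter_upwards [truncate_ae a f, hf] with t h5 h6
    rw [h5]
    by_cases ht : t ∈ Set.Iic a
    · rw [Set.indicator_of_mem ht, Set.indicator_of_mem ht, h6]
    · rw [Set.indicator_of_notMem ht, Set.indicator_of_notMem ht]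
      simp
  rw [h1, h4, integral_indicator measurableSet_Iic, expMeasure,
    setIntegral_withDensity_eq_setIntegral_toReal_smul (measurable_expDensity ν)
      (Filter.Eventually.of_forall fun _ => ENNReal.ofReal_lt_top) _ measurableSet_Iic]
  refine integral_congr_ae (Filter.Eventually.of_forall fun t => ?_)
  simp [ENNReal.toReal_ofReal, Real.exp_nonneg]

/-- The causal energy estimate `ν ‖χ_{(-∞,a]} φ‖ ≤ ‖χ_{(-∞,a]} φ'‖`. -/
theorem norm_truncate_testDeriv (hν : 0 < ν) (a : ℝ) {p q : HSpace ν H}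
    (h : (p, q) ∈ testDerivGraph ν H) : ν * ‖truncate a p‖ ≤ ‖truncate a q‖ := by
  let _ : InnerProductSpace ℝ H := InnerProductSpace.complexToReal
  obtain ⟨φ, hφ, hc, hp, hq⟩ := h
  have hφ' : Continuous (deriv φ) := hφ.continuous_deriv (by simp)
  rw [← sq_le_sq₀ (by positivity) (norm_nonneg _), mul_pow, norm_truncate_sq hp,
    norm_truncate_sq hq]
  set e : ℝ → ℝ := fun t => Real.exp (-2 * ν * t) with he
  have hec : Continuous e := by fun_prop
  have hed : ∀ t, HasDerivAt e (-2 * ν * e t) t := by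
    intro t
    have := ((hasDerivAt_id t).const_mul (-2 * ν)).exp
    simpa [he, mul_comm] using this
  -- The integral of G' over (-∞, a] equals G a ≥ 0. Young's inequality bounds G' by
  -- ν⁻¹e^{-2νt}‖φ'‖² - νG, so integrating and multiplying by ν gives the claim.
  set G : ℝ → ℝ := fun t => e t * ‖φ t‖ ^ 2 with hG
  have hGd : ∀ t, HasDerivAt G (-2 * ν * e t * ‖φ t‖ ^ 2 + e t * (2 * inner ℝ (φ t) (deriv φ t))) t :=
    fun t => (hed t).mul (hφ.differentiable (by simp) t).hasDerivAt.norm_sq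
  have hGs : ContDiff ℝ 1 G := by
    refine ContDiff.mul (by fun_prop) ?_
    exact (hφ.of_le (by simp)).norm_sq ℝ
  have hGc : HasCompactSupport G := (hc.norm.comp_left (g := fun x : ℝ => x ^ 2) (by simp)).mul_left
  have hG'c : HasCompactSupport fun t => e t * ‖deriv φ t‖ ^ 2 :=
    (hc.deriv.norm.comp_left (g := fun x : ℝ => x ^ 2) (by simp)).mul_left
  have hint := hGc.integral_Iic_deriv_eq hGs a
  have hG0 : 0 ≤ G a := by positivity
  have hi1 : Integrable G := hGs.continuous.integrable_of_hasCompactSupport hGc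
  have hi2 : Integrable fun t => e t * ‖deriv φ t‖ ^ 2 :=
    (by fun_prop : Continuous fun t => e t * ‖deriv φ t‖ ^ 2).integrable_of_hasCompactSupport hG'c
  have hi3 : Integrable (deriv G) :=
    (hGs.continuous_deriv le_rfl).integrable_of_hasCompactSupport hGc.deriv
  have hle : ∫ t in Set.Iic a, deriv G t ≤
      ∫ t in Set.Iic a, (ν⁻¹ * (e t * ‖deriv φ t‖ ^ 2) - ν * G t) := by
    refine integral_mono hi3.integrableOn ((hi2.const_mul _).sub (hi1.const_mul _)).integrableOn
      fun t => ?_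
    change deriv G t ≤ ν⁻¹ * (e t * ‖deriv φ t‖ ^ 2) - ν * G t
    rw [(hGd t).deriv, hG]
    have h1 : 2 * inner ℝ (φ t) (deriv φ t) ≤ ν * ‖φ t‖ ^ 2 + ν⁻¹ * ‖deriv φ t‖ ^ 2 := by
      have h2 := real_inner_le_norm (φ t) (deriv φ t)
      have h3 : 0 ≤ ν⁻¹ * (ν * ‖φ t‖ - ‖deriv φ t‖) ^ 2 := by positivity
      have h4 : ν⁻¹ * (ν * ‖φ t‖ - ‖deriv φ t‖) ^ 2 =
          ν * ‖φ t‖ ^ 2 - 2 * (‖φ t‖ * ‖deriv φ t‖) + ν⁻¹ * ‖deriv φ t‖ ^ 2 := by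
        field_simp
        ring
      linarith
    have h5 := mul_le_mul_of_nonneg_left h1 (Real.exp_pos (-2 * ν * t)).le
    change -2 * ν * e t * ‖φ t‖ ^ 2 + e t * (2 * inner ℝ (φ t) (deriv φ t)) ≤
      ν⁻¹ * (e t * ‖deriv φ t‖ ^ 2) - ν * (e t * ‖φ t‖ ^ 2)
    change e t * _ ≤ e t * _ at h5
    linarith
  rw [hint, integral_sub (hi2.const_mul _).integrableOn (hi1.const_mul _).integrableOn,
    integral_const_mul, integral_const_mul] at hle
  have h6 : ν * ∫ t in Set.Iic a, G t ≤ ν⁻¹ * ∫ t in Set.Iic a, e t * ‖deriv φ t‖ ^ 2 := by linarith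
  have h7 := mul_le_mul_of_nonneg_left h6 hν.le
  rw [← mul_assoc, ← mul_assoc, mul_inv_cancel₀ hν.ne', one_mul, ← sq] at h7
  exact h7

/-- `∂₀⁻¹` is causal. -/
theorem isCausal_idLaw_op [CompleteSpace H] {r : ℝ} (hr : 0 < r) (hν : 1 / (2 * r) < ν) :
    IsCausal ((idLaw H r).op hr hν : HSpace ν H → HSpace ν H) := by
  have hν0 : 0 < ν := lt_trans (by positivity) hν
  rw [isCausal_iff]
  intro a f hf
  -- Both sides are continuous in f, so the estimate extends from the dense set of derivatives of
  -- test functions.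
  have key : ν * ‖truncate a ((idLaw H r).op hr hν f)‖ ≤ ‖truncate a f‖ := by
    have hcl : IsClosed {f : HSpace ν H |
        ν * ‖truncate a ((idLaw H r).op hr hν f)‖ ≤ ‖truncate a f‖} :=
      isClosed_le
        (((continuous_truncate a).comp ((idLaw H r).op hr hν).continuous).norm.const_mul ν)
        (continuous_truncate a).norm
    have hsub : {q : HSpace ν H | ∃ p, (p, q) ∈ testDerivGraph ν H} ⊆ {f : HSpace ν H |
        ν * ‖truncate a ((idLaw H r).op hr hν f)‖ ≤ ‖truncate a f‖} := by
      rintro q ⟨p, hp⟩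
      change ν * ‖truncate a ((idLaw H r).op hr hν q)‖ ≤ ‖truncate a q‖
      rw [idLaw_op_testDeriv hr hν hp]
      exact norm_truncate_testDeriv hν0 a hp
    exact closure_minimal hsub hcl (dense_range_testDeriv hν0 f)
  rw [hf, norm_zero] at key
  have : ‖truncate a ((idLaw H r).op hr hν f)‖ ≤ 0 := by
    by_contra! h
    exact absurd key (not_le.2 (mul_pos hν0 h))
  exact norm_le_zero_iff.1 this

end Causality

/-! ### Causality of material laws and the solution operator -/

section MaterialLawCausality

variable {H : Type*} [NormedAddCommGroup H] [InnerProductSpace ℂ H] [CompleteSpace H] {ν : ℝ}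

/-- Polynomials in `∂₀⁻¹` with operator coefficients are causal. -/
theorem exists_causal_hasSymbol_partialSum {r : ℝ} (hr : 0 < r) (hν : 1 / (2 * r) < ν) (ρ : ℂ)
    (p : FormalMultilinearSeries ℂ ℂ (H →L[ℂ] H)) (n : ℕ) :
    ∃ T : HSpace ν H →L[ℂ] HSpace ν H, IsCausal T ∧
      HasSymbol T (fun x => p.partialSum n (ρ * (spectralPoint ν x - r))) := by
  have hpow : ∀ k : ℕ, ∃ T : HSpace ν H →L[ℂ] HSpace ν H, IsCausal T ∧
      HasSymbol T (fun x => (ρ * (spectralPoint ν x - r)) ^ k • ContinuousLinearMap.id ℂ H) := by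
    intro k
    induction k with
    | zero =>
      refine ⟨constOp ν (ContinuousLinearMap.id ℂ H), .constOp _, ?_⟩
      simpa using hasSymbol_constOp (ν := ν) (ContinuousLinearMap.id ℂ H)
    | succ k ih =>
      obtain ⟨T, hT, hT'⟩ := ih
      refine ⟨(constOp ν (ρ • ContinuousLinearMap.id ℂ H) ∘L ((idLaw H r).op hr hν +
        constOp ν (-(r : ℂ) • ContinuousLinearMap.id ℂ H))) ∘L T,
        ((IsCausal.constOp _).comp ((isCausal_idLaw_op hr hν).add (.constOp _))).comp hT, ?_⟩
      convert (((hasSymbol_constOp _).comp (((idLaw H r).hasSymbol_op hr hν).add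
        (hasSymbol_constOp _))).comp hT') using 1
      funext x
      ext y
      simp only [idLaw, Pi.add_apply, add_apply, smul_apply, ContinuousLinearMap.comp_apply,
        ContinuousLinearMap.id_apply]
      module
  induction n with
  | zero =>
    refine ⟨0, .zero, ?_⟩
    have h0 : (fun x => p.partialSum 0 (ρ * (spectralPoint ν x - r))) = 0 := by
      funext x
      simp [FormalMultilinearSeries.partialSum]
    rw [h0]
    exact .zero
  | succ n ih =>
    obtain ⟨T, hT, hT'⟩ := ih
    obtain ⟨S, hS, hS'⟩ := hpow n
    refine ⟨T + constOp ν (p.coeff n) ∘L S, hT.add ((IsCausal.constOp _).comp hS), ?_⟩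
    convert hT'.add ((hasSymbol_constOp _).comp hS') using 1
    funext x
    rw [Pi.add_apply, FormalMultilinearSeries.partialSum, Finset.sum_range_succ]
    congr 1
    ext y
    simp

theorem contract_mem_ball {r ρ : ℝ} (hρ : 0 < ρ) {z : ℂ}
    (hz : z ∈ Metric.ball (r : ℂ) r) : (ρ : ℂ) * (z - r) ∈ Metric.ball (0 : ℂ) (ρ * r) := by
  rw [mem_ball_iff_norm] at hz
  rw [mem_ball_zero_iff, norm_mul, Complex.norm_real, Real.norm_of_nonneg hρ.le]
  exact mul_lt_mul_of_pos_left hz hρ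

theorem add_contract_mem_ball {r ρ : ℝ} (hρ : 0 < ρ) (hρ1 : ρ < 1) {z : ℂ}
    (hz : z ∈ Metric.ball (r : ℂ) r) : (r : ℂ) + ρ * (z - r) ∈ Metric.ball (r : ℂ) r := by
  have h := contract_mem_ball hρ hz
  rw [mem_ball_zero_iff] at h
  rw [mem_ball_iff_norm, add_sub_cancel_left]
  have hr : 0 < r := (norm_nonneg _).trans_lt (mem_ball_iff_norm.1 hz)
  nlinarith

/-- The material law `z ↦ M(r + ρ(z - r))`. -/
def MaterialLaw.contract {r : ℝ} (M : MaterialLaw H r) {ρ : ℝ} (hρ : 0 < ρ) (hρ1 : ρ < 1) :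
    MaterialLaw H r where
  toFun z := M (r + ρ * (z - r))
  analytic := M.analytic.comp (f := fun z : ℂ => (r : ℂ) + ρ * (z - r))
    (analyticOnNhd_const.add (analyticOnNhd_const.mul (analyticOnNhd_id.sub analyticOnNhd_const)))
    (fun _ hz => add_contract_mem_ball hρ hρ1 hz)
  bounded := by
    obtain ⟨C, hC⟩ := M.bounded
    exact ⟨C, fun z hz => hC _ (add_contract_mem_ball hρ hρ1 hz)⟩

theorem MaterialLaw.isCausal_contract_op {r : ℝ} (M : MaterialLaw H r) (hr : 0 < r)
    (hν : 1 / (2 * r) < ν) {ρ : ℝ} (hρ : 0 < ρ) (hρ1 : ρ < 1) :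
    IsCausal ((M.contract hρ hρ1).op hr hν : HSpace ν H → HSpace ν H) := by
  obtain ⟨C, hC⟩ := M.bounded
  -- A radius strictly between ρr and r: the Cauchy series needs M analytic on the closed ball of
  -- radius R, and converges uniformly on the smaller ball of radius ρr, which contains all ρ(z -
  -- r).
  set R : NNReal := ⟨(1 + ρ) / 2 * r, by positivity⟩ with hR
  set R' : NNReal := ⟨ρ * r, by positivity⟩ with hR'
  have hR0 : 0 < R := by
    rw [← NNReal.coe_pos]
    change 0 < (1 + ρ) / 2 * r
    positivity
  have hRR : R' < R := by
    rw [← NNReal.coe_lt_coe]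
    change ρ * r < (1 + ρ) / 2 * r
    nlinarith
  have hd : DifferentiableOn ℂ M.toFun (Metric.closedBall (r : ℂ) R) := by
    refine M.analytic.differentiableOn.mono (Metric.closedBall_subset_ball ?_)
    change (1 + ρ) / 2 * r < r
    nlinarith
  have hp := (hd.hasFPowerSeriesOnBall hR0).tendstoUniformlyOn (ENNReal.coe_lt_coe.2 hRR)
  set p := cauchyPowerSeries M.toFun (r : ℂ) R
  have hmem : ∀ x, (ρ : ℂ) * (spectralPoint ν x - r) ∈ Metric.ball (0 : ℂ) R' := fun x =>
    contract_mem_ball hρ (spectralPoint_mem hr hν x)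
  obtain ⟨N, hN⟩ := Filter.eventually_atTop.1 (Metric.tendstoUniformlyOn_iff.1 hp 1 one_pos)
  -- Starting at N keeps every partial sum within 1 of M, which supplies the uniform bound C + 1.
  choose T hT hT' using fun n => exists_causal_hasSymbol_partialSum hr hν (ρ : ℂ) p (n + N)
  refine IsCausal.of_tendsto hT fun f => HasSymbol.tendsto (C := C + 1) hT'
    ((M.contract hρ hρ1).hasSymbol_op hr hν) (fun n x => ?_) (fun x => ?_) f
  · have h1 := hN (n + N) (Nat.le_add_left N n) _ (hmem x)
    rw [dist_comm, dist_eq_norm] at h1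
    have h2 := hC _ (add_contract_mem_ball hρ hρ1 (spectralPoint_mem hr hν x))
    have h3 := norm_le_insert' (p.partialSum (n + N) (ρ * (spectralPoint ν x - r)))
      (M (r + ρ * (spectralPoint ν x - r)))
    linarith
  · change Filter.Tendsto (fun n => p.partialSum (n + N) (ρ * (spectralPoint ν x - r))) Filter.atTop
      (nhds (M (r + ρ * (spectralPoint ν x - r))))
    exact (hp.tendsto_at (hmem x)).comp (Filter.tendsto_add_atTop_nat N)

/-- `M(∂₀⁻¹)` is causal for every linear material law `M`. -/
theorem MaterialLaw.isCausal_op {r : ℝ} (M : MaterialLaw H r) (hr : 0 < r)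
    (hν : 1 / (2 * r) < ν) : IsCausal (M.op hr hν : HSpace ν H → HSpace ν H) := by
  obtain ⟨C, hC⟩ := M.bounded
  -- As ρ increases to 1 the contracted laws keep the bound C. Their symbols converge pointwise
  -- because each spectral point is interior to the ball; no boundary behaviour of M enters.
  obtain ⟨ρ, -, hρ, hlim⟩ := exists_seq_strictMono_tendsto' (zero_lt_one (α := ℝ))
  refine IsCausal.of_tendsto (fun n => M.isCausal_contract_op hr hν (hρ n).1 (hρ n).2) fun f =>
    HasSymbol.tendsto (C := C) (fun n => (M.contract (hρ n).1 (hρ n).2).hasSymbol_op hr hν)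
      (M.hasSymbol_op hr hν)
      (fun n x => hC _ (add_contract_mem_ball (hρ n).1 (hρ n).2 (spectralPoint_mem hr hν x)))
      (fun x => ?_) f
  have hz := spectralPoint_mem hr hν x
  have hcont : ContinuousAt M.toFun (spectralPoint ν x) := (M.analytic _ hz).continuousAt
  refine hcont.tendsto.comp ?_
  have h1 : Filter.Tendsto (fun n => (r : ℂ) + (ρ n : ℂ) * (spectralPoint ν x - r)) Filter.atTop
      (nhds ((r : ℂ) + ((1 : ℝ) : ℂ) * (spectralPoint ν x - r))) :=
    (((Complex.continuous_ofReal.tendsto 1).comp hlim).mul_const _).const_add _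
  simpa using h1

/-- Well-posedness and causality for evolutionary equations `(∂₀ M(∂₀⁻¹) + A) u = f` with
skew-selfadjoint `A`. -/
theorem exists_causal_solutionOperator {A : H →ₗ.[ℂ] H} {R : H →L[ℂ] H} (hR : IsSkewResolvent A R)
    {r : ℝ} (hr : 0 < r) (M : MaterialLaw H r) {c : ℝ} (hc : 0 < c)
    (hM : ∀ z ∈ Metric.ball (r : ℂ) r, RePartGE (z⁻¹ • M z) c) (hν : 1 / (2 * r) < ν) :
    ∃ T : HSpace ν H →L[ℂ] HSpace ν H,
      IsSolutionOperator (evolutionOp hr M A hν) T ∧ IsCausal T := by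
  have hne : ∀ z ∈ Metric.ball (r : ℂ) r, z ≠ 0 := by
    rintro z hz rfl
    rw [mem_ball_iff_norm, zero_sub, norm_neg, Complex.norm_real, Real.norm_of_nonneg hr.le] at hz
    exact lt_irrefl _ hz
  let S : MaterialLaw H r :=
    { toFun := fun z => resolventAt R (z⁻¹ • M z)
      analytic := hR.resolventAt_analyticOnNhd hc hM
        ((analyticOnNhd_id.inv hne).smul M.analytic)
      bounded := ⟨c⁻¹, fun z hz => hR.resolventAt_norm_le hc (hM z hz)⟩ }
  have hS := S.hasSymbol_op hr hν
  have hMs := M.hasSymbol_op hr hν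
  have hD := (idLaw H r).hasSymbol_op hr hν
  have hRs := hasSymbol_constOp (ν := ν) R
  have hz : ∀ x, spectralPoint ν x ∈ Metric.ball (r : ℂ) r := spectralPoint_mem hr hν
  have hext : ∀ u f, (u, f) ∈ evolutionOp hr M A hν → S.op hr hν f = u := by
    rintro u f ⟨v, w, h1, h2, h3⟩
    dsimp only at h1 h2 h3
    rw [mem_timeDeriv_iff hr hν] at h1
    rw [hR.mem_extension_iff] at h2
    rw [h3]
    apply (fourierLaplace ν H).injective
    apply Lp.ext
    have e1 := hD v
    rw [h1] at e1
    have e2 := hRs (u + w)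
    rw [h2] at e2
    filter_upwards [e1, e2, hS (v + w), hMs u,
      Lp.coeFn_add (fourierLaplace ν H u) (fourierLaplace ν H w),
      Lp.coeFn_add (fourierLaplace ν H v) (fourierLaplace ν H w)] with x e1 e2 e3 e4 e5 e6
    rw [map_add, e5, Pi.add_apply] at e2
    rw [e3, map_add, e6, Pi.add_apply]
    -- The transformed relation ∂₀⁻¹v = M(∂₀⁻¹)u, divided by the nonzero scalar z.
    have e7 : fourierLaplace ν H v x =
        ((spectralPoint ν x)⁻¹ • M (spectralPoint ν x)) (fourierLaplace ν H u x) := by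
      rw [smul_apply, ← e4, e1]
      exact (inv_smul_smul₀ (hne _ (hz x)) _).symm
    rw [e7]
    exact hR.resolventAt_left_inv hc (hM _ (hz x)) e2.symm
  have hdense : Dense {f : HSpace ν H | ∃ u, (u, f) ∈ evolutionOp hr M A hν} := by
    refine (denseRange_idLaw_op hr hν).mono ?_
    rintro _ ⟨g, rfl⟩
    set D := (idLaw H r).op hr hν
    -- For a general right-hand side f, M(∂₀⁻¹)S(∂₀⁻¹)f need not lie in the domain of ∂₀. For f =
    -- ∂₀⁻¹g it does: the scalar symbol of ∂₀⁻¹ commutes with everything, so the derivative is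
    -- M(∂₀⁻¹)S(∂₀⁻¹)g.
    refine ⟨S.op hr hν (D g), M.op hr hν (S.op hr hν g), D g - M.op hr hν (S.op hr hν g),
      ?_, ?_, by simp⟩
    · rw [mem_timeDeriv_iff hr hν]
      apply (fourierLaplace ν H).injective
      apply Lp.ext
      filter_upwards [hD (M.op hr hν (S.op hr hν g)), hMs (S.op hr hν g), hS g,
        hMs (S.op hr hν (D g)), hS (D g), hD g] with x e1 e2 e3 e4 e5 e6
      rw [e1, e2, e3, e4, e5, e6]
      simp [idLaw]
    · rw [hR.mem_extension_iff]
      apply (fourierLaplace ν H).injective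
      apply Lp.ext
      filter_upwards [hRs (S.op hr hν (D g) + (D g - M.op hr hν (S.op hr hν g))),
        hMs (S.op hr hν g), hS g, hS (D g), hD g,
        Lp.coeFn_add (fourierLaplace ν H (S.op hr hν (D g)))
          (fourierLaplace ν H (D g) - fourierLaplace ν H (M.op hr hν (S.op hr hν g))),
        Lp.coeFn_sub (fourierLaplace ν H (D g)) (fourierLaplace ν H (M.op hr hν (S.op hr hν g)))]
        with x e1 e2 e3 e4 e5 e6 e7
      have e8 : fourierLaplace ν H (D g) x = spectralPoint ν x • fourierLaplace ν H g x := e5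
      have e9 : M (spectralPoint ν x) (S (spectralPoint ν x) (fourierLaplace ν H g x)) =
          ((spectralPoint ν x)⁻¹ • M (spectralPoint ν x))
            (S (spectralPoint ν x) (fourierLaplace ν H (D g) x)) := by
        rw [e8, smul_apply, map_smul, map_smul, inv_smul_smul₀ (hne _ (hz x))]
      rw [e1, map_add, map_sub, e6, Pi.add_apply, e7, Pi.sub_apply, e2, e3, e4, e9]
      exact hR.resolventAt_right_inv hc (hM _ (hz x)) _
  refine ⟨S.op hr hν, ⟨⟨fun u hu => ?_, hdense, ⟨‖S.op hr hν‖, fun u f h => ?_⟩⟩, hext⟩,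
    S.isCausal_op hr hν⟩
  · rw [← hext u 0 hu, map_zero]
  · rw [← hext u f h]
    exact (S.op hr hν).le_opNorm f

end MaterialLawCausality

/-! ### Accretivity of the system's material law -/

namespace AbstractLinearControlSystem

variable {H₀ H₁ U Y : Type*}
  [NormedAddCommGroup H₀] [InnerProductSpace ℂ H₀] [CompleteSpace H₀]
  [NormedAddCommGroup H₁] [InnerProductSpace ℂ H₁] [CompleteSpace H₁]
  [NormedAddCommGroup U] [InnerProductSpace ℂ U] [CompleteSpace U]
  [NormedAddCommGroup Y] [InnerProductSpace ℂ Y] [CompleteSpace Y]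
  (𝒞 : AbstractLinearControlSystem H₀ H₁ U Y)

/-- The real part sees only the selfadjoint part of the constant block, whose off-diagonal entries
are J and J*; together they contribute 2 Re ⟨x, J y⟩. -/
theorem re_inner_inv_smul_M {z : ℂ} (hz : z ≠ 0) (w : StateSpace H₀ H₁ Y) :
    (inner ℂ w ((z⁻¹ • 𝒞.M z) w)).re =
      (inner ℂ w.fst ((z⁻¹ • 𝒞.K z) w.fst)).re + 2 * (inner ℂ w.fst (𝒞.J w.snd)).re +
        (inner ℂ w.snd (𝒞.M₁₂₂ w.snd)).re := by
  have hw : (z⁻¹ • 𝒞.M z) w = z⁻¹ • block (𝒞.K z) 0 0 0 w + 𝒞.M₁ w := by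
    change z⁻¹ • (block (𝒞.K z) 0 0 0 w + z • 𝒞.M₁ w) = _
    rw [smul_add, inv_smul_smul₀ hz]
  have h₂₀ : (inner ℂ w.snd (𝒞.M₁₂₀ w.fst.fst)).re =
      (inner ℂ w.fst.fst (𝒞.M₁₂₀.adjoint w.snd)).re := by
    rw [ContinuousLinearMap.adjoint_inner_right, ← inner_conj_symm, Complex.conj_re]
  have h₂₁ : (inner ℂ w.snd (𝒞.M₁₂₁ w.fst.snd)).re =
      (inner ℂ w.fst.snd (𝒞.M₁₂₁.adjoint w.snd)).re := by
    rw [ContinuousLinearMap.adjoint_inner_right, ← inner_conj_symm, Complex.conj_re]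
  have hJ : (inner ℂ w.fst (𝒞.J w.snd)).re = 1 / 2 *
      ((inner ℂ w.fst.fst (𝒞.M₁₀₂ w.snd)).re + (inner ℂ w.fst.fst (𝒞.M₁₂₀.adjoint w.snd)).re +
        ((inner ℂ w.fst.snd (𝒞.M₁₁₂ w.snd)).re +
          (inner ℂ w.fst.snd (𝒞.M₁₂₁.adjoint w.snd)).re)) := by
    have h : inner ℂ w.fst (𝒞.J w.snd) = ((1 / 2 : ℝ) : ℂ) *
        (inner ℂ w.fst.fst (𝒞.M₁₀₂ w.snd + 𝒞.M₁₂₀.adjoint w.snd) +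
          inner ℂ w.fst.snd (𝒞.M₁₁₂ w.snd + 𝒞.M₁₂₁.adjoint w.snd)) := by
      change inner ℂ w.fst ((1 / 2 : ℂ) • column (𝒞.M₁₀₂ + 𝒞.M₁₂₀.adjoint)
        (𝒞.M₁₁₂ + 𝒞.M₁₂₁.adjoint) w.snd) = _
      rw [inner_smul_right, WithLp.prod_inner_apply]
      push_cast
      rfl
    rw [h, Complex.re_ofReal_mul, inner_add_right, inner_add_right]
    simp only [Complex.add_re]
  have hblock : inner ℂ w (block (𝒞.K z) 0 0 0 w) = inner ℂ w.fst (𝒞.K z w.fst) := by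
    simp [block, column, WithLp.prod_inner_apply]
  have hM₁ : (inner ℂ w (𝒞.M₁ w)).re = (inner ℂ w.fst.fst (𝒞.M₁₀₂ w.snd)).re +
      (inner ℂ w.fst.snd (𝒞.M₁₁₂ w.snd)).re + ((inner ℂ w.snd (𝒞.M₁₂₀ w.fst.fst)).re +
        (inner ℂ w.snd (𝒞.M₁₂₁ w.fst.snd)).re + (inner ℂ w.snd (𝒞.M₁₂₂ w.snd)).re) := by
    simp [M₁, block, column, WithLp.prod_inner_apply, inner_add_right]
  rw [hw, inner_add_right, inner_smul_right, hblock, smul_apply, inner_smul_right, Complex.add_re,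
    hM₁, h₂₀, h₂₁, hJ]
  ring

theorem rePartGE_inv_smul_M {c₀ c₁ δ : ℝ} (hδ : 0 < δ) {z : ℂ} (hz : z ≠ 0)
    (hK : RePartGE (z⁻¹ • 𝒞.K z) c₀) (hM : RePartGE 𝒞.M₁₂₂ c₁) :
    RePartGE (z⁻¹ • 𝒞.M z) (min (c₀ - δ * ‖𝒞.J‖) (c₁ - 1 / δ * ‖𝒞.J‖)) := by
  intro w
  rw [𝒞.re_inner_inv_smul_M hz, WithLp.prod_norm_sq_eq_of_L2]
  have h1 := hK w.fst
  have h2 := hM w.snd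
  have h3 : -(‖𝒞.J‖ * (δ * ‖w.fst‖ ^ 2 + 1 / δ * ‖w.snd‖ ^ 2)) ≤
      2 * (inner ℂ w.fst (𝒞.J w.snd)).re := by
    have h4 : -(‖w.fst‖ * (‖𝒞.J‖ * ‖w.snd‖)) ≤ (inner ℂ w.fst (𝒞.J w.snd)).re := by
      refine (neg_le_neg ?_).trans (neg_le_of_abs_le (Complex.abs_re_le_norm _))
      exact (norm_inner_le_norm _ _).trans
        (mul_le_mul_of_nonneg_left (𝒞.J.le_opNorm _) (norm_nonneg _))
    -- Young's inequality 2ab ≤ δa² + b²/δ, from the square (δa - b)² ≥ 0.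
    have h5 : 0 ≤ ‖𝒞.J‖ * (1 / δ * (δ * ‖w.fst‖ - ‖w.snd‖) ^ 2) := by positivity
    have h6 : 1 / δ * (δ * ‖w.fst‖ - ‖w.snd‖) ^ 2 =
        δ * ‖w.fst‖ ^ 2 - 2 * (‖w.fst‖ * ‖w.snd‖) + 1 / δ * ‖w.snd‖ ^ 2 := by
      field_simp
      ring
    rw [h6] at h5
    linarith
  have h7 := mul_le_mul_of_nonneg_right
    (min_le_left (c₀ - δ * ‖𝒞.J‖) (c₁ - 1 / δ * ‖𝒞.J‖)) (sq_nonneg ‖w.fst‖)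
  have h8 := mul_le_mul_of_nonneg_right
    (min_le_right (c₀ - δ * ‖𝒞.J‖) (c₁ - 1 / δ * ‖𝒞.J‖)) (sq_nonneg ‖w.snd‖)
  linarith

end AbstractLinearControlSystem

end ControlSystems

end

theorem theorem3p2 {H₀ H₁ U Y : Type*}
    [NormedAddCommGroup H₀] [InnerProductSpace ℂ H₀] [CompleteSpace H₀]
    [NormedAddCommGroup H₁] [InnerProductSpace ℂ H₁] [CompleteSpace H₁]
    [NormedAddCommGroup U] [InnerProductSpace ℂ U] [CompleteSpace U]
    [NormedAddCommGroup Y] [InnerProductSpace ℂ Y] [CompleteSpace Y]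
    (𝒞 : ControlSystems.AbstractLinearControlSystem H₀ H₁ U Y)
    (c₀ c₁ δ : ℝ) (hc₀ : 0 < c₀) (hc₁ : 0 < c₁) (hδ : 0 < δ)
    (hK : ∀ z ∈ Metric.ball (𝒞.r : ℂ) 𝒞.r, ControlSystems.RePartGE (z⁻¹ • 𝒞.K z) c₀)
    (hM : ControlSystems.RePartGE 𝒞.M₁₂₂ c₁)
    (hJ₀ : 0 < c₀ - δ * ‖𝒞.J‖) (hJ₁ : 0 < c₁ - 1 / δ * ‖𝒞.J‖) :
    𝒞.WellPosed ∧
      ∃ ν₀ : ℝ, ∀ (ν : ℝ) (hν : 1 / (2 * 𝒞.r) < ν), ν₀ ≤ ν →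
        ∃ T : ControlSystems.HSpace ν (ControlSystems.StateSpace H₀ H₁ Y) →L[ℂ]
            ControlSystems.HSpace ν (ControlSystems.StateSpace H₀ H₁ Y),
          ControlSystems.IsSolutionOperator (𝒞.systemOp hν) T ∧ ControlSystems.IsCausal T := by
  have key : ∀ (ν : ℝ) (hν : 1 / (2 * 𝒞.r) < ν),
      ∃ T : ControlSystems.HSpace ν (ControlSystems.StateSpace H₀ H₁ Y) →L[ℂ]
          ControlSystems.HSpace ν (ControlSystems.StateSpace H₀ H₁ Y),
        ControlSystems.IsSolutionOperator (𝒞.systemOp hν) T ∧ ControlSystems.IsCausal T := by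
    intro ν hν
    refine ControlSystems.exists_causal_solutionOperator 𝒞.isSkewResolvent 𝒞.r_pos 𝒞.M
      (lt_min hJ₀ hJ₁) (fun z hz => 𝒞.rePartGE_inv_smul_M hδ ?_ (hK z hz) hM) hν
    rintro rfl
    rw [mem_ball_iff_norm, zero_sub, norm_neg, Complex.norm_real,
      Real.norm_of_nonneg 𝒞.r_pos.le] at hz
    exact lt_irrefl _ hz
  -- Everything holds for each ν > 1/(2r), so 0 serves as a vacuous threshold.
  refine ⟨⟨0, fun ν hν _ => ?_⟩, 0, fun ν hν _ => key ν hν⟩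
  obtain ⟨T, hT, -⟩ := key ν hν
  exact hT.hasInverse
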